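/- Let $k=\mathbb F_q$ be a finite field. Let $\pi:X\to C$ be a ruled surface over $k$: $C$ is a smooth projective geometrically integral curve over $k$, $X$ is a smooth projective geometrically integral surface over $k$, $\pi$ is a $k$-morphism whose fibre over every closed point $y\in C$ is isomorphic to $\mathbb P^1_{\kappa(y)}$ over $\kappa(y)$, and $\pi$ has a section $\sigma:C\to X$ with image $C_0$. Assume that it is normalized, i.e. for the rank-2 bundle $\mathcal E=\pi_*\mathcal O_X(C_0)$ (so that $X\cong\mathbb P(\mathcal E)$) one has $H^0(C,\mathcal E)\neq 0$, and $H^0(C,\mathcal E\otimes\mathcal O_C(\mathfrak b))=H^0(X,\mathcal O_X(C_0+\pi^*\mathfrak b))=0$ for every divisor $\mathfrak b$ on $C$ with $\deg\mathfrak b<0$; and assume that its invariant $e=-C_0^2$ satisfies $e\ge 0$. Put $a=\#C(\mathbb F_q)$, let $\mathcal S=X(\mathbb F_q)$ be the set of all rational points of $X$, and $n=\#\mathcal S$. Let $b_1,b_2\in\mathbb Z$, let $\mathfrak b$ be a divisor of degree $b_2$ on $C$ defined over $\mathbb F_q$ (for instance $b_2$ times a rational point, in which case $\pi^*\mathfrak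 b=b_2f$ for a fibre $f$ of $\pi$), and let $\mathcal L=\mathcal O_X(b_1C_0+\pi^*\mathfrak b)$. For any choice of local trivializations of $\mathcal L$ at the points of $\mathcal S$, let $C(X,\mathcal L;\mathcal S)\subseteq\mathbb F_q^{\,n}$ be the image of the map $\Gamma(X,\mathcal L)\to\bigoplus_{P\in\mathcal S}\mathcal L_P/\mathfrak m_P\mathcal L_P\cong\mathbb F_q^{\,n}$. If $$b_2<a\qquad\text{and}\qquad n-b_2(q+1)-(a-b_2)b_1>0,$$ then $a$ and $n$ are finite and $n=a(q+1)$, the divisor $b_1C_0+\pi^*\mathfrak b$ is locally principal (so $\mathcal L$ is a line bundle), $\Gamma(X,\mathcal L)$ is finite-dimensional over $\mathbb F_q$, and the code $C(X,\mathcal L;\mathcal S)$ has length $n=a(q+1)$, dimension $\dim_{\mathbb F_q}\Gamma(X,\mathcal L)$, and minimum distance $$d\ \ge\ n-b_2(q+1)-(a-b_2)b_1$$ (a code with only the zero codeword is given $d=\infty$). -/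

import Mathlib

open CategoryTheory AlgebraicGeometry

universe u

noncomputable section

namespace RuledCode

/-! ### Schemes over a field: scalars, rational points, closed points, the projective line -/

section Basics

variable {k : Type u} [Field k] {X : Scheme.{u}}

/-- The scalars `k → 𝒪_{X,x}` of the local ring at `x` of a scheme `s : X ⟶ Spec k`. -/
def scalarHom (s : X ⟶ Spec (.of k)) (x : X) : k →+* X.presheaf.stalk x :=
  ((Scheme.ΓSpecIso (.of k)).inv ≫ s.appTop ≫ X.presheaf.germ ⊤ x (TopologicalSpace.Opens.mem_top x)).hom

/-- The scalars `k → κ(x)` of the residue field at `x`. -/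
def residueScalarHom (s : X ⟶ Spec (.of k)) (x : X) : k →+* X.residueField x :=
  (X.residue x).hom.comp (scalarHom s x)

/-- The `k`-rational points `X(k)`: the points with residue field `k`. -/
def RationalPoint (s : X ⟶ Spec (.of k)) : Type u :=
  {x : X // Function.Bijective (residueScalarHom s x)}

/-- The value in `k` of a germ at a rational point. -/
def value (s : X ⟶ Spec (.of k)) (P : RationalPoint s) : X.presheaf.stalk P.1 →+* k :=
  (RingEquiv.ofBijective _ P.2).symm.toRingHom.comp (X.residue P.1).hom

theorem value_scalarHom (s : X ⟶ Spec (.of k)) (P : RationalPoint s) (c : k) :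
    value s P (scalarHom s P.1 c) = c :=
  (RingEquiv.ofBijective _ P.2).symm_apply_apply c

/-- Closed points of a scheme. -/
def ClosedPoint (X : Scheme.{u}) : Type u := {x : X // IsClosed ({x} : Set X)}

/-- Divisors on a curve: finite formal `ℤ`-combinations of closed points. -/
abbrev CurveDivisor (C : Scheme.{u}) : Type u := ClosedPoint C →₀ ℤ

open Classical in
/-- The multiplicity of a divisor at a point of the scheme (`0` at a non-closed point). -/
def coeff {C : Scheme.{u}} (𝔟 : CurveDivisor C) (y : C) : ℤ :=
  if h : IsClosed ({y} : Set C) then 𝔟 ⟨y, h⟩ else 0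

/-- The degree `∑ 𝔟(p) [κ(p) : k]` of a divisor on a curve over `k`. -/
def degree {C : Scheme.{u}} (s : C ⟶ Spec (.of k)) (𝔟 : CurveDivisor C) : ℤ :=
  𝔟.sum fun p n => n * (s.residueDegree p.1 : ℤ)

/-- The projective line `Proj K[x₀, x₁]` as a scheme over `Spec K`. -/
def projLine (K : Type u) [Field K] : Over (Spec (.of K)) :=
  letI : GradedAlgebra (MvPolynomial.homogeneousSubmodule (Fin 2) K) := MvPolynomial.gradedAlgebra
  Over.mk (Proj.toSpecZero (MvPolynomial.homogeneousSubmodule (Fin 2) K) ≫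
    Spec.map (CommRingCat.ofHom
      (algebraMap K (MvPolynomial.homogeneousSubmodule (Fin 2) K 0))))

end Basics

/-! ### Ruled surfaces -/

/-- A ruled surface `π : X ⟶ C` over `k`, with a chosen section `σ`: `C` is a smooth complete
geometrically integral curve, `X` a smooth complete geometrically integral surface, and the
fibre of `π` over every closed point `y` of `C` is the projective line over `κ(y)`.
(Smooth complete curves and surfaces are projective.) -/
structure RuledSurface (k : Type u) [Field k] where
  X : Scheme.{u}
  C : Scheme.{u}
  strX : X ⟶ Spec (.of k)
  strC : C ⟶ Spec (.of k)
  π : X ⟶ C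
  σ : C ⟶ X
  π_over : π ≫ strC = strX
  σ_π : σ ≫ π = 𝟙 C
  integralX : IsIntegral X
  integralC : IsIntegral C
  geomIntegralX : GeometricallyIntegral strX
  geomIntegralC : GeometricallyIntegral strC
  properX : IsProper strX
  properC : IsProper strC
  smoothX : SmoothOfRelativeDimension 2 strX
  smoothC : SmoothOfRelativeDimension 1 strC
  fiber_projLine : ∀ y : C, IsClosed ({y} : Set C) →
    Nonempty (Over.mk (π.fiberToSpecResidueField y) ≅ projLine (C.residueField y))

namespace RuledSurface

variable {k : Type u} [Field k] (R : RuledSurface k)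

instance : IsIntegral R.X := R.integralX

instance : IsIntegral R.C := R.integralC

/-- Local rings, and in particular the function field, of `X` are `k`-algebras. -/
instance (x : R.X) : Algebra k (R.X.presheaf.stalk x) := (scalarHom R.strX x).toAlgebra

/-- The stalk at `x` of the ideal sheaf `ker (𝒪_X → σ_* 𝒪_C)` of the curve `C₀ = σ(C)`:
germs of the sections of `𝒪_X` near `x` that vanish on `C₀`. -/
def idealC₀ (x : R.X) : Ideal (R.X.presheaf.stalk x) :=
  Ideal.span {u | ∃ (U : R.X.Opens) (hx : x ∈ U) (a : Γ(R.X, U)),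
    R.σ.app U a = 0 ∧ R.X.presheaf.germ U x hx a = u}

/-- `t ∈ K(C)` is a local equation of the divisor `𝔡` at the point `y` of `C`:
`t = w ϖ ^ 𝔡(y)` with `w` a unit and `ϖ` a generator of the maximal ideal of `𝒪_{C,y}`. -/
def IsCurveEquation (𝔡 : CurveDivisor R.C) (y : R.C) (t : R.C.functionField) : Prop :=
  ∃ (w : (R.C.presheaf.stalk y)ˣ) (ϖ : R.C.presheaf.stalk y),
    Ideal.span {ϖ} = IsLocalRing.maximalIdeal (R.C.presheaf.stalk y) ∧
    t = algebraMap (R.C.presheaf.stalk y) R.C.functionField w *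
      algebraMap (R.C.presheaf.stalk y) R.C.functionField ϖ ^ coeff 𝔡 y

/-- `t ∈ K(X)` is a local equation at `x` of the divisor `D = b₁ C₀ + π^*𝔟`:
`t = w g ^ b₁ (π^*ϖ) ^ 𝔟(π x)` with `w` a unit of `𝒪_{X,x}`, `g` a local equation of `C₀` at `x`
and `ϖ` a generator of the maximal ideal of `𝒪_{C,π x}`. -/
def IsLocalEquation (b₁ : ℤ) (𝔟 : CurveDivisor R.C) (x : R.X) (t : R.X.functionField) : Prop :=
  ∃ (w : (R.X.presheaf.stalk x)ˣ) (g : R.X.presheaf.stalk x)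
    (ϖ : R.C.presheaf.stalk (R.π x)),
    Ideal.span {g} = R.idealC₀ x ∧
    Ideal.span {ϖ} = IsLocalRing.maximalIdeal (R.C.presheaf.stalk (R.π x)) ∧
    t = algebraMap (R.X.presheaf.stalk x) R.X.functionField w *
      algebraMap (R.X.presheaf.stalk x) R.X.functionField g ^ b₁ *
      algebraMap (R.X.presheaf.stalk x) R.X.functionField (R.π.stalkMap x ϖ) ^ coeff 𝔟 (R.π x)

theorem algebraMap_scalar (x : R.X) (c : k) :
    algebraMap (R.X.presheaf.stalk x) R.X.functionField (scalarHom R.strX x c) =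
      algebraMap k R.X.functionField c := by
  have h := R.X.presheaf.germ_stalkSpecializes (U := ⊤) (TopologicalSpace.Opens.mem_top x)
    ((genericPoint_spec R.X).specializes trivial)
  exact congrArg (fun φ => φ.hom (R.strX.appTop ((Scheme.ΓSpecIso (.of k)).inv c))) h

/-- The space of global sections `Γ(X, 𝒪_X(b₁ C₀ + π^*𝔟))`, where `𝒪_X(D)` is the
subsheaf of the constant sheaf `K(X)` whose stalk at `x` is `t⁻¹ 𝒪_{X,x}`, for `t` a local
equation of `D` at `x`. -/
def sections (b₁ : ℤ) (𝔟 : CurveDivisor R.C) : Submodule k R.X.functionField where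
  carrier := {f | ∀ (x : R.X) (t : R.X.functionField), R.IsLocalEquation b₁ 𝔟 x t →
    ∃ u : R.X.presheaf.stalk x, algebraMap (R.X.presheaf.stalk x) R.X.functionField u = f * t}
  zero_mem' := fun x t _ => ⟨0, by simp⟩
  add_mem' := fun {f g} hf hg x t ht => by
    obtain ⟨u, hu⟩ := hf x t ht
    obtain ⟨v, hv⟩ := hg x t ht
    exact ⟨u + v, by rw [map_add, hu, hv, add_mul]⟩
  smul_mem' := fun c f hf x t ht => by
    obtain ⟨u, hu⟩ := hf x t ht
    exact ⟨scalarHom R.strX x c * u, by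
      rw [map_mul, hu, algebraMap_scalar, Algebra.smul_def, mul_assoc]⟩

/-- The section `C₀` is normalized: for `ℰ = π_* 𝒪_X(C₀)`, the rank `2` bundle on `C` with
`X = ℙ(ℰ)` and `𝒪_{ℙ(ℰ)}(1) = 𝒪_X(C₀)`, one has `H⁰(C, ℰ) ≠ 0`, and `H⁰(C, ℰ ⊗ 𝒪_C(𝔟)) = 0` for
every `𝔟` of negative degree.  Here `H⁰(C, ℰ ⊗ 𝒪_C(𝔟)) = Γ(X, 𝒪_X(C₀ + π^*𝔟))`. -/
def IsNormalized : Prop :=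
  R.sections 1 0 ≠ ⊥ ∧ ∀ 𝔟 : CurveDivisor R.C, degree R.strC 𝔟 < 0 → R.sections 1 𝔟 = ⊥

/-- `C₀² = m`, that is `deg σ^*𝒪_X(C₀) = m`: for some `r ∈ K(X)` the divisor `C₀ + div r` does not
contain `C₀`, and pulls back under `σ` to a divisor `𝔡` of degree `m` on `C`.  At a closed point
`p`, with `g` a local equation of `C₀` at `σ p`, this means that `r g = u / v` with `u`, `v` in
the local ring of `X` at `σ p` not vanishing on `C₀`, and that `σ^*u / σ^*v` is a local
equation of `𝔡` at `p`. -/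
def SelfIntersection (m : ℤ) : Prop :=
  ∃ (r : R.X.functionField) (𝔡 : CurveDivisor R.C), degree R.strC 𝔡 = m ∧
    ∀ p : R.C, IsClosed ({p} : Set R.C) →
      ∃ g u v : R.X.presheaf.stalk (R.σ p),
        Ideal.span {g} = R.idealC₀ (R.σ p) ∧
        r * algebraMap (R.X.presheaf.stalk (R.σ p)) R.X.functionField g *
          algebraMap (R.X.presheaf.stalk (R.σ p)) R.X.functionField v =
          algebraMap (R.X.presheaf.stalk (R.σ p)) R.X.functionField u ∧
        R.σ.stalkMap p u ≠ 0 ∧ R.σ.stalkMap p v ≠ 0 ∧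
        R.IsCurveEquation 𝔡 p
          (algebraMap (R.C.presheaf.stalk p) R.C.functionField (R.σ.stalkMap p u) /
            algebraMap (R.C.presheaf.stalk p) R.C.functionField (R.σ.stalkMap p v))

/-- The invariant of the normalized ruled surface is `e = -C₀²`. -/
def HasInvariant (e : ℤ) : Prop := R.SelfIntersection (-e)

/-! ### The code -/

/-- A choice of a local trivialization of `ℒ = 𝒪_X(b₁ C₀ + π^*𝔟)` at each rational point `P` of `X`:
multiplication by a local equation `t P` maps `ℒ_P = (t P)⁻¹ 𝒪_{X,P}` isomorphically onto
`𝒪_{X,P}`. -/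
structure Trivialization (b₁ : ℤ) (𝔟 : CurveDivisor R.C) where
  t : RationalPoint R.strX → R.X.functionField
  isLocalEquation : ∀ P, R.IsLocalEquation b₁ 𝔟 P.1 (t P)

variable {R}

/-- The germ at `P` of a global section of `ℒ`, as an element of `𝒪_{X,P}` through the chosen
trivialization. -/
def Trivialization.germ {b₁ : ℤ} {𝔟 : CurveDivisor R.C} (τ : R.Trivialization b₁ 𝔟)
    (P : RationalPoint R.strX) (f : R.sections b₁ 𝔟) : R.X.presheaf.stalk P.1 :=
  (f.2 P.1 (τ.t P) (τ.isLocalEquation P)).choose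

theorem Trivialization.algebraMap_germ {b₁ : ℤ} {𝔟 : CurveDivisor R.C}
    (τ : R.Trivialization b₁ 𝔟) (P : RationalPoint R.strX) (f : R.sections b₁ 𝔟) :
    algebraMap (R.X.presheaf.stalk P.1) R.X.functionField (τ.germ P f) = f.1 * τ.t P :=
  (f.2 P.1 (τ.t P) (τ.isLocalEquation P)).choose_spec

/-- The germ map `α : Γ(X, ℒ) → ⨁_P ℒ_P / 𝔪_P ℒ_P ≃ k ^ n`, over all rational points `P` of `X`. -/
def Trivialization.germMap {b₁ : ℤ} {𝔟 : CurveDivisor R.C} (τ : R.Trivialization b₁ 𝔟) :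
    R.sections b₁ 𝔟 →ₗ[k] (RationalPoint R.strX → k) where
  toFun f P := value R.strX P (τ.germ P f)
  map_add' f g := by
    funext P
    have h : τ.germ P (f + g) = τ.germ P f + τ.germ P g := by
      apply IsFractionRing.injective (R.X.presheaf.stalk P.1) R.X.functionField
      rw [map_add]
      simp only [τ.algebraMap_germ]
      exact add_mul _ _ _
    simp [h]
  map_smul' c f := by
    funext P
    have h : τ.germ P (c • f) = scalarHom R.strX P.1 c * τ.germ P f := by
      apply IsFractionRing.injective (R.X.presheaf.stalk P.1) R.X.functionField
      rw [map_mul, algebraMap_scalar]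
      simp only [τ.algebraMap_germ]
      rw [← mul_assoc, ← Algebra.smul_def]
      rfl
    simp [h, value_scalarHom]

/-- The code `C(X, ℒ; X(k))`: the image of the germ map. -/
def Trivialization.code {b₁ : ℤ} {𝔟 : CurveDivisor R.C} (τ : R.Trivialization b₁ 𝔟) :
    Submodule k (RationalPoint R.strX → k) :=
  LinearMap.range τ.germMap

end RuledSurface

/-- The minimum distance of a code: the least number of positions in which two distinct
codewords differ (`⊤` if there is only one codeword). -/
def minDist {ι k : Type*} [Field k] (E : Submodule k (ι → k)) : ℕ∞ :=
  ⨅ (c ∈ E) (c' ∈ E) (_ : c ≠ c'), {i | c i ≠ c' i}.encard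

end RuledCode

end

/-!
The zeros of a nonzero section of `𝒪_X(b₁ C₀ + π^* 𝔟)` are counted fibre by fibre. Every fibre
over a rational point of `C` is a projective line, with `q + 1` rational points. A section that
does not vanish identically on such a fibre restricts to a nonzero section of `𝒪(b₁)`, which has at
most `b₁` zeros. If it vanishes identically on `m` fibres, then dividing by the equations of these
fibres leaves a section of `𝒪_X(b₁ C₀ + π^* 𝔟')` with `deg 𝔟' = deg 𝔟 - m`. Split off `C₀` from
its divisor as often as possible, say `i` times, and restrict to `C₀`: the result is a nonzero
section of a line bundle of degree `deg 𝔟' - (b₁ - i) e` on `C`, so `deg 𝔟' ≥ (b₁ - i) e ≥ 0` by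
normalization, that is, `m ≤ deg 𝔟 = b₂`. As `n = a (q + 1)`, the hypothesis forces `b₁ ≤ q + 1`,
so the number of zeros is at most `m (q + 1) + (a - m) b₁ ≤ b₂ (q + 1) + (a - b₂) b₁`.
-/

noncomputable section

namespace RuledCode

/-! ### The standard charts of the projective line -/

theorem eval₂_smul_of_isHomogeneous {σ R L : Type*} [CommSemiring R] [CommSemiring L] (φ : R →+* L)
    {n : ℕ} {p : MvPolynomial σ R} (hp : p.IsHomogeneous n) (a : L) (w : σ → L) :
    p.eval₂ φ (a • w) = a ^ n * p.eval₂ φ w := by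
  rw [MvPolynomial.eval₂_eq, MvPolynomial.eval₂_eq, Finset.mul_sum]
  refine Finset.sum_congr rfl fun d hd => ?_
  simp only [Pi.smul_apply, smul_eq_mul, mul_pow, Finset.prod_mul_distrib,
    Finset.prod_pow_eq_pow_sum, ← hp.degree_eq_sum_deg_support hd]
  exact mul_left_comm _ _ _

section ProjRing

open HomogeneousLocalization

variable (K : Type u) [Field K]

/-- The grading of `K[x₀, x₁]` by degree. -/
abbrev lineGrading : ℕ → Submodule K (MvPolynomial (Fin 2) K) :=
  MvPolynomial.homogeneousSubmodule (Fin 2) K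

instance : GradedAlgebra (lineGrading K) := MvPolynomial.gradedAlgebra

theorem X_mem_lineGrading (i : Fin 2) :
    (MvPolynomial.X i : MvPolynomial (Fin 2) K) ∈ lineGrading K 1 :=
  MvPolynomial.isHomogeneous_X K i

/-- The coordinate ring of the chart `xᵢ ≠ 0`. -/
abbrev LineAway (i : Fin 2) : Type u :=
  Away (lineGrading K) (MvPolynomial.X i : MvPolynomial (Fin 2) K)

/-- The coordinate `xⱼ / xᵢ` on the chart `xᵢ ≠ 0`. -/
def awayCoord (i j : Fin 2) : LineAway K i :=
  Away.mk (lineGrading K) (X_mem_lineGrading K i) 1 (MvPolynomial.X j)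
    ((one_smul ℕ 1).symm ▸ X_mem_lineGrading K j)

/-- The constants in the coordinate ring of the chart `xᵢ ≠ 0`. -/
def awayScalar (i : Fin 2) : K →+* LineAway K i :=
  (fromZeroRingHom (lineGrading K) _).comp (algebraMap K (lineGrading K 0))

theorem val_awayScalar (i : Fin 2) (c : K) : (awayScalar K i c).val =
    algebraMap (MvPolynomial (Fin 2) K) _ (MvPolynomial.C c) :=
  Localization.mk_one_eq_algebraMap _

theorem val_awayCoord_mul (i j : Fin 2) :
    (awayCoord K i j).val * algebraMap (MvPolynomial (Fin 2) K) _ (MvPolynomial.X i) =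
      algebraMap (MvPolynomial (Fin 2) K) _ (MvPolynomial.X j) := by
  rw [awayCoord, Away.val_mk, Localization.mk_eq_mk']
  simp only [pow_one]
  exact IsLocalization.mk'_spec _ _ _

/-- Polynomials in the coordinate `xⱼ / xᵢ` as elements of the coordinate ring of the chart
`xᵢ ≠ 0`. -/
def awayEval (i j : Fin 2) : Polynomial K →+* LineAway K i :=
  Polynomial.eval₂RingHom (awayScalar K i) (awayCoord K i j)

/-- The substitution `xᵢ ↦ 1`, `xⱼ ↦ T` for `j ≠ i`. -/
def dehomogenize (i : Fin 2) : MvPolynomial (Fin 2) K →+* Polynomial K :=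
  MvPolynomial.eval₂Hom Polynomial.C fun l => if l = i then 1 else Polynomial.X

theorem dehomogenize_X_self (i : Fin 2) : dehomogenize K i (MvPolynomial.X i) = 1 :=
  (MvPolynomial.eval₂Hom_X' _ _ _).trans (if_pos rfl)

theorem isUnit_dehomogenize_X_self (i : Fin 2) : IsUnit (dehomogenize K i (MvPolynomial.X i)) :=
  dehomogenize_X_self K i ▸ isUnit_one

theorem dehomogenize_X_of_ne {i j : Fin 2} (hij : i ≠ j) :
    dehomogenize K i (MvPolynomial.X j) = Polynomial.X :=
  (MvPolynomial.eval₂Hom_X' _ _ _).trans (if_neg hij.symm)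

theorem dehomogenize_C (i : Fin 2) (c : K) :
    dehomogenize K i (MvPolynomial.C c) = Polynomial.C c :=
  MvPolynomial.eval₂Hom_C _ _ _

/-- The substitution `xᵢ ↦ 1`, `xⱼ ↦ T` on the coordinate ring of the chart `xᵢ ≠ 0`. -/
def awayDehomogenize (i : Fin 2) : LineAway K i →+* Polynomial K :=
  (IsLocalization.Away.lift (MvPolynomial.X i) (isUnit_dehomogenize_X_self K i)).comp
    (algebraMap _ (Localization.Away (MvPolynomial.X i : MvPolynomial (Fin 2) K)))

theorem awayDehomogenize_eq_of_val_mul_eq {i : Fin 2} {z : LineAway K i}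
    {p : MvPolynomial (Fin 2) K}
    (h : z.val * algebraMap (MvPolynomial (Fin 2) K) _ (MvPolynomial.X i) = algebraMap _ _ p) :
    awayDehomogenize K i z = dehomogenize K i p := by
  have hmul := congrArg
    (IsLocalization.Away.lift (MvPolynomial.X i) (isUnit_dehomogenize_X_self K i)) h
  rwa [map_mul, IsLocalization.Away.lift_eq, IsLocalization.Away.lift_eq, dehomogenize_X_self,
    mul_one] at hmul

theorem awayDehomogenize_comp_awayEval {i j : Fin 2} (hij : i ≠ j) :
    (awayDehomogenize K i).comp (awayEval K i j) = RingHom.id _ := by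
  refine Polynomial.ringHom_ext (fun c => ?_) ?_
  · rw [RingHom.comp_apply, awayEval, Polynomial.coe_eval₂RingHom, Polynomial.eval₂_C,
      awayDehomogenize_eq_of_val_mul_eq K (p := MvPolynomial.C c * MvPolynomial.X i), map_mul,
      dehomogenize_C, dehomogenize_X_self, mul_one, RingHom.id_apply]
    rw [val_awayScalar, map_mul]
  · rw [RingHom.comp_apply, awayEval, Polynomial.coe_eval₂RingHom, Polynomial.eval₂_X,
      awayDehomogenize_eq_of_val_mul_eq K (val_awayCoord_mul K i j), dehomogenize_X_of_ne K hij,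
      RingHom.id_apply]

theorem val_awayEval_dehomogenize {i j : Fin 2} (hij : i ≠ j) {n : ℕ}
    {p : MvPolynomial (Fin 2) K} (hp : p ∈ lineGrading K n) :
    (awayEval K i j (dehomogenize K i p)).val *
      algebraMap (MvPolynomial (Fin 2) K) _ (MvPolynomial.X i) ^ n = algebraMap _ _ p := by
  let L := Localization.Away (MvPolynomial.X i : MvPolynomial (Fin 2) K)
  let ι : MvPolynomial (Fin 2) K →+* L := algebraMap _ _
  let θ : Polynomial K →+* L := (algebraMap (LineAway K i) L).comp (awayEval K i j)
  have hθ : (θ.comp (dehomogenize K i)).comp MvPolynomial.C = ι.comp MvPolynomial.C := by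
    ext c
    simp only [RingHom.comp_apply, dehomogenize_C, θ, awayEval, Polynomial.coe_eval₂RingHom,
      Polynomial.eval₂_C]
    exact val_awayScalar K i c
  let w : Fin 2 → L := fun l => θ (dehomogenize K i (MvPolynomial.X l))
  have hw : ι (MvPolynomial.X i) • w = fun l => ι (MvPolynomial.X l) := by
    funext l
    rw [Pi.smul_apply, smul_eq_mul]
    by_cases hl : l = i
    · simp only [w, hl, dehomogenize_X_self, map_one, mul_one]
    · obtain rfl : j = l := by omega
      simp only [w, dehomogenize_X_of_ne K hij, θ, RingHom.comp_apply, awayEval,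
        Polynomial.coe_eval₂RingHom, Polynomial.eval₂_X]
      exact (mul_comm _ _).trans (val_awayCoord_mul K i j)
  have heval (ψ : MvPolynomial (Fin 2) K →+* L) :
      ψ p = p.eval₂ (ψ.comp MvPolynomial.C) fun l => ψ (MvPolynomial.X l) := by
    conv_lhs => rw [← MvPolynomial.eval₂_eta p]
    rw [MvPolynomial.hom_eval₂]
  refine Eq.trans ?_ (heval ι).symm
  rw [← hw, eval₂_smul_of_isHomogeneous _ hp, mul_comm]
  exact congrArg _ ((heval (θ.comp (dehomogenize K i))).trans (by rw [hθ]; rfl))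

theorem bijective_awayEval {i j : Fin 2} (hij : i ≠ j) : Function.Bijective (awayEval K i j) := by
  refine ⟨Function.HasLeftInverse.injective
    ⟨awayDehomogenize K i, DFunLike.congr_fun (awayDehomogenize_comp_awayEval K hij)⟩, fun z => ?_⟩
  obtain ⟨n, p, hp, rfl⟩ := Away.mk_surjective (lineGrading K) (X_mem_lineGrading K i) z
  have hp' : p ∈ lineGrading K n := by rwa [smul_eq_mul, mul_one] at hp
  refine ⟨dehomogenize K i p, val_injective _ ?_⟩
  rw [Away.val_mk, Localization.mk_eq_mk', IsLocalization.eq_mk'_iff_mul_eq, map_pow]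
  exact val_awayEval_dehomogenize K hij hp'

theorem exists_X_notMem (x : Proj (lineGrading K)) :
    ∃ i, MvPolynomial.X i ∉ x.asHomogeneousIdeal := by
  by_contra! hx
  refine x.not_irrelevant_le fun p hp => ?_
  have hp0 : MvPolynomial.coeff 0 p = 0 := by
    have h : MvPolynomial.homogeneousComponent 0 p = 0 :=
      (MvPolynomial.decomposition.decompose'_apply p 0).symm.trans
        ((HomogeneousIdeal.mem_irrelevant_iff (lineGrading K) p).mp hp)
    rwa [MvPolynomial.homogeneousComponent_zero, map_eq_zero] at h
  rw [MvPolynomial.as_sum p]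
  refine Ideal.sum_mem _ fun d hd => ?_
  have hd0 : d ≠ 0 := by
    rintro rfl
    exact MvPolynomial.mem_support_iff.mp hd hp0
  obtain ⟨i, hi⟩ := Finsupp.ne_iff.mp hd0
  rw [MvPolynomial.monomial_eq]
  refine Ideal.mul_mem_left _ _ (Ideal.mem_of_dvd _ (Finset.dvd_prod_of_mem _
    (Finsupp.mem_support_iff.mpr hi)) ?_)
  exact Ideal.pow_mem_of_mem _ (hx i) _ (Nat.pos_of_ne_zero hi)

end ProjRing

section LineCharts

variable {K : Type u} [Field K] {F : Scheme.{u}}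

/-- The scalars `K → Γ(F, U)` of a scheme `s : F ⟶ Spec K`. -/
def sectionScalarHom (s : F ⟶ Spec (.of K)) (U : F.Opens) : K →+* Γ(F, U) :=
  ((Scheme.ΓSpecIso (.of K)).inv ≫ s.appTop ≫ F.presheaf.map (homOfLE le_top).op).hom

theorem germ_sectionScalarHom (s : F ⟶ Spec (.of K)) (U : F.Opens) (x : F) (hx : x ∈ U) (c : K) :
    F.presheaf.germ U x hx (sectionScalarHom s U c) = scalarHom s x c := by
  simp only [sectionScalarHom, scalarHom, CommRingCat.hom_comp, RingHom.comp_apply]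
  exact F.presheaf.germ_res_apply _ x hx _

/-- An affine open subscheme with a coordinate that identifies it with the affine line. -/
structure LineChart (s : F ⟶ Spec (.of K)) where
  U : F.Opens
  isAffineOpen : IsAffineOpen U
  t : Γ(F, U)
  bijective : Function.Bijective (Polynomial.eval₂RingHom (sectionScalarHom s U) t)

/-- Two affine lines with coordinates `t₀`, `t₁` that cover `F` and are glued along
`t₀ t₁ = 1`: the standard charts of a projective line. -/
structure ProjLineCharts (s : F ⟶ Spec (.of K)) where
  c₀ : LineChart s
  c₁ : LineChart s
  cover : ∀ x : F, x ∈ c₀.U ∨ x ∈ c₁.U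
  mul_germ : ∀ (x : F) (h₀ : x ∈ c₀.U) (h₁ : x ∈ c₁.U),
    F.presheaf.germ c₀.U x h₀ c₀.t * F.presheaf.germ c₁.U x h₁ c₁.t = 1
  mem₁ : ∀ (x : F) (h₀ : x ∈ c₀.U), IsUnit (F.presheaf.germ c₀.U x h₀ c₀.t) → x ∈ c₁.U
  mem₀ : ∀ (x : F) (h₁ : x ∈ c₁.U), IsUnit (F.presheaf.germ c₁.U x h₁ c₁.t) → x ∈ c₀.U

/-- The two charts of a projective line in the opposite order. -/
def ProjLineCharts.swap {s : F ⟶ Spec (.of K)} (D : ProjLineCharts s) : ProjLineCharts s where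
  c₀ := D.c₁
  c₁ := D.c₀
  cover x := (D.cover x).symm
  mul_germ x h₀ h₁ := (mul_comm _ _).trans (D.mul_germ x h₁ h₀)
  mem₁ := D.mem₀
  mem₀ := D.mem₁

end LineCharts

section ProjCharts

open HomogeneousLocalization

variable (K : Type u) [Field K]

/-- The chart `xᵢ ≠ 0` of the projective line. -/
abbrev lineOpen (i : Fin 2) : (Proj (lineGrading K)).Opens :=
  Proj.basicOpen (lineGrading K) (MvPolynomial.X i)

theorem lineOpen_ι_toSpecZero (i : Fin 2) :
    (lineOpen K i).ι ≫ Proj.toSpecZero (lineGrading K) =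
      Proj.basicOpenToSpec (lineGrading K) (MvPolynomial.X i) ≫
        Spec.map (CommRingCat.ofHom (fromZeroRingHom (lineGrading K) _)) := by
  rw [← Proj.awayι_toSpecZero _ _ (X_mem_lineGrading K i) one_pos, Proj.awayι,
    ← Proj.basicOpenIsoSpec_hom _ _ (X_mem_lineGrading K i) one_pos, Category.assoc,
    Iso.hom_inv_id_assoc]

/-- The structure morphism of the projective line. -/
def lineStr : Proj (lineGrading K) ⟶ Spec (.of K) :=
  Proj.toSpecZero (lineGrading K) ≫ Spec.map (CommRingCat.ofHom (algebraMap K (lineGrading K 0)))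

theorem lineOpen_ι_lineStr (i : Fin 2) : (lineOpen K i).ι ≫ lineStr K =
    Proj.basicOpenToSpec (lineGrading K) (MvPolynomial.X i) ≫
      Spec.map (CommRingCat.ofHom (awayScalar K i)) := by
  rw [lineStr, ← Category.assoc, lineOpen_ι_toSpecZero, Category.assoc, ← Spec.map_comp]
  rfl

theorem sectionScalarHom_lineStr (i : Fin 2) (c : K) :
    sectionScalarHom (lineStr K) (lineOpen K i) c =
      Proj.awayToSection (lineGrading K) (MvPolynomial.X i) (awayScalar K i c) := by
  have happ := congrArg Scheme.Hom.appTop (lineOpen_ι_lineStr K i)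
  have hspec : (Proj.basicOpenToSpec (lineGrading K) (MvPolynomial.X i)).appTop = _ :=
    Proj.basicOpenToSpec_app_top (lineGrading K) (MvPolynomial.X i)
  rw [Scheme.Hom.comp_appTop, Scheme.Hom.comp_appTop, hspec, Scheme.ΓSpecIso_naturality_assoc,
    ← Iso.inv_comp_eq] at happ
  have h : (Scheme.ΓSpecIso (.of K)).inv ≫ (lineStr K).appTop ≫
      (Proj (lineGrading K)).presheaf.map (homOfLE (le_top : lineOpen K i ≤ ⊤)).op =
      CommRingCat.ofHom (awayScalar K i) ≫
        Proj.awayToSection (lineGrading K) (MvPolynomial.X i) := by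
    rw [← cancel_mono (lineOpen K i).topIso.inv]
    simp only [Category.assoc]
    rw [← happ]
    congr 2
  exact congrArg (fun φ => φ.hom c) h

theorem bijective_awayToSection (i : Fin 2) : Function.Bijective
    (Proj.awayToSection (lineGrading K) (MvPolynomial.X i)) := by
  have : IsIso (Proj.awayToSection (lineGrading K) (MvPolynomial.X i)) :=
    (Proj.basicOpenIsoAway _ _ (X_mem_lineGrading K i) one_pos).isIso_hom
  exact ConcreteCategory.bijective_of_isIso _

/-- The coordinate `xⱼ / xᵢ` as a section over the chart `xᵢ ≠ 0`. -/
def lineCoord (i j : Fin 2) : Γ(Proj (lineGrading K), lineOpen K i) :=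
  Proj.awayToSection (lineGrading K) (MvPolynomial.X i) (awayCoord K i j)

/-- The chart `xᵢ ≠ 0` of the projective line with the coordinate `xⱼ / xᵢ`. -/
def projLineChart {i j : Fin 2} (hij : i ≠ j) : LineChart (lineStr K) where
  U := lineOpen K i
  isAffineOpen := Proj.isAffineOpen_basicOpen _ _ (X_mem_lineGrading K i) one_pos
  t := lineCoord K i j
  bijective := by
    have h : Polynomial.eval₂RingHom (sectionScalarHom (lineStr K) (lineOpen K i))
        (lineCoord K i j) =
        (Proj.awayToSection (lineGrading K) (MvPolynomial.X i)).hom.comp (awayEval K i j) := by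
      refine Polynomial.ringHom_ext (fun c => ?_) ?_
      · simp only [awayEval, RingHom.comp_apply, Polynomial.coe_eval₂RingHom, Polynomial.eval₂_C,
          sectionScalarHom_lineStr]
      · simp only [awayEval, RingHom.comp_apply, Polynomial.coe_eval₂RingHom, Polynomial.eval₂_X,
          lineCoord]
    rw [h, RingHom.coe_comp]
    exact (bijective_awayToSection K i).comp (bijective_awayEval K hij)

instance (x : Proj (lineGrading K)) : x.asHomogeneousIdeal.toIdeal.IsPrime := x.isPrime

/-- The stalk of the projective line at `x`, as a homogeneous localization of `K[x₀, x₁]`. -/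
def lineStalkEquiv (x : Proj (lineGrading K)) : (Proj (lineGrading K)).presheaf.stalk x ≃+*
    HomogeneousLocalization (lineGrading K) x.asHomogeneousIdeal.toIdeal.primeCompl :=
  Proj.stalkIso' (lineGrading K) x

variable {K}

theorem lineStalkEquiv_germ_awayToSection {i : Fin 2} {x : Proj (lineGrading K)}
    (hi : x ∈ lineOpen K i) (z : LineAway K i) :
    lineStalkEquiv K x ((Proj (lineGrading K)).presheaf.germ _ x hi
      (Proj.awayToSection (lineGrading K) (MvPolynomial.X i) z)) =
      HomogeneousLocalization.mapId (lineGrading K) (Submonoid.powers_le.mpr hi) z := by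
  have h : (Proj (lineGrading K)).presheaf.germ _ x hi
      (Proj.awayToSection (lineGrading K) (MvPolynomial.X i) z) =
      (lineStalkEquiv K x).symm
        (HomogeneousLocalization.mapId (lineGrading K) (Submonoid.powers_le.mpr hi) z) :=
    congrArg (fun φ => φ.hom z)
      (ProjectiveSpectrum.Proj.awayToSection_germ (lineGrading K) (MvPolynomial.X i) x hi)
  rw [h, RingEquiv.apply_symm_apply]

theorem val_germ_lineCoord_mul {i : Fin 2} (j : Fin 2) {x : Proj (lineGrading K)}
    (hi : x ∈ lineOpen K i) :
    (lineStalkEquiv K x ((Proj (lineGrading K)).presheaf.germ _ x hi (lineCoord K i j))).val *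
        algebraMap (MvPolynomial (Fin 2) K) _ (MvPolynomial.X i) =
      algebraMap (MvPolynomial (Fin 2) K) _ (MvPolynomial.X j) := by
  rw [lineCoord, lineStalkEquiv_germ_awayToSection]
  have hspec := IsLocalization.mk'_spec
    (Localization x.asHomogeneousIdeal.toIdeal.primeCompl)
    (MvPolynomial.X j : MvPolynomial (Fin 2) K)
    (⟨(MvPolynomial.X i : MvPolynomial (Fin 2) K) ^ 1, by rwa [pow_one]⟩ :
      x.asHomogeneousIdeal.toIdeal.primeCompl)
  rw [← Localization.mk_eq_mk'] at hspec
  simp only [pow_one] at hspec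
  refine Eq.trans (congrArg (· * _) ?_) hspec
  exact congrArg (Localization.mk _) (Subtype.ext (pow_one _))

theorem isUnit_algebraMap_X {i : Fin 2} {x : Proj (lineGrading K)} (hi : x ∈ lineOpen K i) :
    IsUnit (algebraMap (MvPolynomial (Fin 2) K)
      (Localization x.asHomogeneousIdeal.toIdeal.primeCompl) (MvPolynomial.X i)) :=
  IsLocalization.map_units _ (⟨_, hi⟩ : x.asHomogeneousIdeal.toIdeal.primeCompl)

theorem germ_lineCoord_mul {i j : Fin 2} {x : Proj (lineGrading K)} (hi : x ∈ lineOpen K i)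
    (hj : x ∈ lineOpen K j) :
    (Proj (lineGrading K)).presheaf.germ _ x hi (lineCoord K i j) *
      (Proj (lineGrading K)).presheaf.germ _ x hj (lineCoord K j i) = 1 := by
  apply (lineStalkEquiv K x).injective
  rw [map_one, map_mul]
  apply val_injective
  rw [val_mul, val_one]
  apply (isUnit_algebraMap_X hj).mul_right_cancel
  rw [mul_assoc, val_germ_lineCoord_mul, val_germ_lineCoord_mul, one_mul]

theorem mem_lineOpen_of_isUnit_germ {i j : Fin 2} {x : Proj (lineGrading K)}
    (hi : x ∈ lineOpen K i)
    (h : IsUnit ((Proj (lineGrading K)).presheaf.germ _ x hi (lineCoord K i j))) :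
    x ∈ lineOpen K j := by
  have hX := ((h.map (lineStalkEquiv K x)).map
    (algebraMap _ (Localization x.asHomogeneousIdeal.toIdeal.primeCompl))).mul
      (isUnit_algebraMap_X hi)
  exact (IsLocalization.AtPrime.isUnit_to_map_iff _ x.asHomogeneousIdeal.toIdeal _).mp
    (val_germ_lineCoord_mul j hi ▸ hX)

variable (K) in
/-- The standard charts of the projective line. -/
def projLineCharts : ProjLineCharts (lineStr K) where
  c₀ := projLineChart K zero_ne_one
  c₁ := projLineChart K one_ne_zero
  cover x := Fin.exists_fin_two.mp (exists_X_notMem K x)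
  mul_germ _ := germ_lineCoord_mul
  mem₁ _ := mem_lineOpen_of_isUnit_germ
  mem₀ _ := mem_lineOpen_of_isUnit_germ

end ProjCharts

/-! ### Points and local rings of an affine open subscheme -/

section Affine

variable {F : Scheme.{u}} {U : F.Opens}

theorem isUnit_germ_iff (hU : IsAffineOpen U) {x : F} (hx : x ∈ U) (a : Γ(F, U)) :
    IsUnit (F.presheaf.germ U x hx a) ↔ a ∉ (hU.primeIdealOf ⟨x, hx⟩).asIdeal := by
  let := F.presheaf.algebra_section_stalk (⟨x, hx⟩ : U)
  have := hU.isLocalization_stalk ⟨x, hx⟩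
  exact IsLocalization.AtPrime.isUnit_to_map_iff (F.presheaf.stalk x)
    (hU.primeIdealOf ⟨x, hx⟩).asIdeal a

theorem exists_germ_mul_eq (hU : IsAffineOpen U) {x : F} (hx : x ∈ U) (u : F.presheaf.stalk x) :
    ∃ a b : Γ(F, U), IsUnit (F.presheaf.germ U x hx b) ∧
      u * F.presheaf.germ U x hx b = F.presheaf.germ U x hx a := by
  let := F.presheaf.algebra_section_stalk (⟨x, hx⟩ : U)
  have := hU.isLocalization_stalk ⟨x, hx⟩
  obtain ⟨⟨a, b⟩, h⟩ := IsLocalization.surj (hU.primeIdealOf ⟨x, hx⟩).asIdeal.primeCompl u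
  exact ⟨a, b, (isUnit_germ_iff hU hx _).mpr b.2, h⟩

theorem exists_mem_primeIdealOf_eq (hU : IsAffineOpen U) (q : PrimeSpectrum Γ(F, U)) :
    ∃ (x : F) (hx : x ∈ U), hU.primeIdealOf ⟨x, hx⟩ = q := by
  have hx : hU.fromSpec q ∈ U := by
    have : hU.fromSpec q ∈ Set.range hU.fromSpec := ⟨q, rfl⟩
    rwa [hU.range_fromSpec] at this
  refine ⟨hU.fromSpec q, hx, ?_⟩
  apply hU.fromSpec.isOpenEmbedding.injective
  exact hU.fromSpec_primeIdealOf ⟨_, hx⟩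

theorem specializes_of_primeIdealOf_le (hU : IsAffineOpen U) {x y : F} (hx : x ∈ U) (hy : y ∈ U)
    (h : (hU.primeIdealOf ⟨x, hx⟩).asIdeal ≤ (hU.primeIdealOf ⟨y, hy⟩).asIdeal) : x ⤳ y := by
  have h1 : hU.primeIdealOf ⟨x, hx⟩ ⤳ hU.primeIdealOf ⟨y, hy⟩ :=
    (PrimeSpectrum.le_iff_specializes _ _).mp h
  have h2 := h1.map hU.fromSpec.continuous
  rwa [hU.fromSpec_primeIdealOf, hU.fromSpec_primeIdealOf] at h2

theorem specializes_of_isUnit_germ (hU : IsAffineOpen U) {x y : F} (hx : x ∈ U) (hy : y ∈ U)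
    (h : ∀ a, IsUnit (F.presheaf.germ U y hy a) → IsUnit (F.presheaf.germ U x hx a)) : x ⤳ y := by
  refine specializes_of_primeIdealOf_le hU hx hy fun a ha => ?_
  by_contra hb
  exact (isUnit_germ_iff hU hx a).mp (h a ((isUnit_germ_iff hU hy a).mpr hb)) ha

end Affine

section LineChartPoints

open Polynomial

variable {K : Type u} [Field K] {F : Scheme.{u}} {s : F ⟶ Spec (.of K)}

namespace LineChart

variable (c : LineChart s)

/-- The isomorphism of `K[T]` with the coordinate ring of a chart. -/
def equiv : K[X] ≃+* Γ(F, c.U) := RingEquiv.ofBijective _ c.bijective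

/-- The germ at a point of the chart of a polynomial in the coordinate. -/
def germ (x : F) (hx : x ∈ c.U) : K[X] →+* F.presheaf.stalk x :=
  (F.presheaf.germ c.U x hx).hom.comp c.equiv.toRingHom

@[simp]
theorem germ_C (x : F) (hx : x ∈ c.U) (a : K) : c.germ x hx (C a) = scalarHom s x a := by
  change F.presheaf.germ c.U x hx (eval₂ (sectionScalarHom s c.U) c.t (C a)) = _
  rw [eval₂_C, germ_sectionScalarHom]

@[simp]
theorem germ_X (x : F) (hx : x ∈ c.U) : c.germ x hx X = F.presheaf.germ c.U x hx c.t := by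
  change F.presheaf.germ c.U x hx (eval₂ (sectionScalarHom s c.U) c.t X) = _
  rw [eval₂_X]

theorem exists_germ_mul_eq {x : F} (hx : x ∈ c.U) (u : F.presheaf.stalk x) :
    ∃ a b : K[X], IsUnit (c.germ x hx b) ∧ u * c.germ x hx b = c.germ x hx a := by
  obtain ⟨a, b, hb, h⟩ := RuledCode.exists_germ_mul_eq c.isAffineOpen hx u
  refine ⟨c.equiv.symm a, c.equiv.symm b, ?_, ?_⟩ <;> simpa [germ]

theorem exists_point (𝔭 : Ideal K[X]) [𝔭.IsPrime] :
    ∃ (x : F) (hx : x ∈ c.U), ∀ p, IsUnit (c.germ x hx p) ↔ p ∉ 𝔭 := by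
  obtain ⟨x, hx, h⟩ := exists_mem_primeIdealOf_eq c.isAffineOpen
    ⟨𝔭.comap c.equiv.symm.toRingHom, inferInstance⟩
  refine ⟨x, hx, fun p => (isUnit_germ_iff c.isAffineOpen hx (c.equiv p)).trans ?_⟩
  rw [h]
  simp

theorem specializes {x y : F} (hx : x ∈ c.U) (hy : y ∈ c.U)
    (h : ∀ p, IsUnit (c.germ y hy p) → IsUnit (c.germ x hx p)) : x ⤳ y := by
  refine specializes_of_isUnit_germ c.isAffineOpen hx hy fun a => ?_
  simpa [germ] using h (c.equiv.symm a)

theorem isDomain_stalk {x : F} (hx : x ∈ c.U) : IsDomain (F.presheaf.stalk x) := by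
  let := F.presheaf.algebra_section_stalk (⟨x, hx⟩ : c.U)
  have := c.isAffineOpen.isLocalization_stalk ⟨x, hx⟩
  have : IsDomain Γ(F, c.U) := c.equiv.symm.toMulEquiv.isDomain _
  exact IsLocalization.isDomain_of_atPrime (F.presheaf.stalk x)
    (c.isAffineOpen.primeIdealOf ⟨x, hx⟩).asIdeal

theorem germ_injective [IsIntegral F] {x : F} (hx : x ∈ c.U) : Function.Injective (c.germ x hx) :=
  (germ_injective_of_isIntegral F x hx).comp c.equiv.injective

end LineChart

theorem LineChart.exists_forall_specializes (c : LineChart s) :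
    ∃ (x : F) (hx : x ∈ c.U), IsUnit (F.presheaf.germ c.U x hx c.t) ∧ ∀ z ∈ c.U, x ⤳ z := by
  obtain ⟨x, hx, h⟩ := c.exists_point ⊥
  refine ⟨x, hx, ?_, fun z hz => ?_⟩
  · rw [← c.germ_X, h]
    exact X_ne_zero
  · have := c.isDomain_stalk hz
    refine c.specializes hx hz fun p hp => (h p).mpr ?_
    rintro rfl
    exact not_isUnit_zero (map_zero (c.germ z hz) ▸ hp)

namespace ProjLineCharts

theorem exists_forall_specializes (D : ProjLineCharts s) : ∃ x : F, ∀ z, x ⤳ z := by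
  obtain ⟨x, hx, hxt, hxs⟩ := D.c₀.exists_forall_specializes
  obtain ⟨y, hy, hyt, hys⟩ := D.c₁.exists_forall_specializes
  have hxy : x = y := ((hxs y (D.mem₀ y hy hyt)).antisymm (hys x (D.mem₁ x hx hxt))).eq
  exact ⟨x, fun z => (D.cover z).elim (hxs z) fun hz => hxy ▸ hys z hz⟩

theorem isIntegral (D : ProjLineCharts s) : IsIntegral F := by
  have (z : F) : _root_.IsReduced (F.presheaf.stalk z) := by
    have := (D.cover z).elim D.c₀.isDomain_stalk D.c₁.isDomain_stalk
    infer_instance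
  have := isReduced_of_isReduced_stalk F
  obtain ⟨x, hx⟩ := D.exists_forall_specializes
  have hclosure : closure {x} = (⊤ : Set F) :=
    Set.eq_univ_of_forall fun z => specializes_iff_mem_closure.mp (hx z)
  have : IrreducibleSpace F :=
    (irreducibleSpace_def F).mpr (hclosure ▸ (isIrreducible_singleton (x := x)).closure)
  exact isIntegral_of_irreducibleSpace_of_isReduced F

end ProjLineCharts

variable {F' : Scheme.{u}} {s' : F' ⟶ Spec (.of K)}

theorem sectionScalarHom_preimage (φ : F' ⟶ F) (h : φ ≫ s = s') (U : F.Opens) (a : K) :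
    sectionScalarHom s' (φ ⁻¹ᵁ U) a = φ.app U (sectionScalarHom s U a) := by
  subst h
  simp only [sectionScalarHom, CommRingCat.hom_comp, RingHom.comp_apply, Scheme.Hom.comp_appTop]
  exact (congrArg (fun ψ => ψ.hom (s.appTop.hom ((Scheme.ΓSpecIso (.of K)).inv.hom a)))
    (φ.naturality (homOfLE (le_top : U ≤ ⊤)).op)).symm

/-- The inverse image of a chart under an isomorphism. -/
def LineChart.preimage (c : LineChart s) (φ : F' ⟶ F) [IsIso φ] (h : φ ≫ s = s') :
    LineChart s' where
  U := φ ⁻¹ᵁ c.U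
  isAffineOpen := c.isAffineOpen.preimage_of_isIso φ
  t := φ.app c.U c.t
  bijective := by
    have h1 : eval₂RingHom (sectionScalarHom s' (φ ⁻¹ᵁ c.U)) (φ.app c.U c.t) =
        (φ.app c.U).hom.comp (eval₂RingHom (sectionScalarHom s c.U) c.t) := by
      apply Polynomial.ringHom_ext
      · intro a
        simp [sectionScalarHom_preimage φ h]
      · simp
    rw [h1, RingHom.coe_comp]
    exact (ConcreteCategory.bijective_of_isIso (φ.app c.U)).comp c.bijective

theorem LineChart.germ_preimage_t (c : LineChart s) (φ : F' ⟶ F) [IsIso φ] (h : φ ≫ s = s')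
    (x : F') (hx : x ∈ (c.preimage φ h).U) :
    F'.presheaf.germ (c.preimage φ h).U x hx (c.preimage φ h).t =
      φ.stalkMap x (F.presheaf.germ c.U (φ x) hx c.t) :=
  (φ.germ_stalkMap_apply c.U x hx c.t).symm

/-- The inverse images of the two charts under an isomorphism. -/
def ProjLineCharts.preimage (D : ProjLineCharts s) (φ : F' ⟶ F) [IsIso φ] (h : φ ≫ s = s') :
    ProjLineCharts s' where
  c₀ := D.c₀.preimage φ h
  c₁ := D.c₁.preimage φ h
  cover x := D.cover (φ x)
  mul_germ x h₀ h₁ := by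
    rw [LineChart.germ_preimage_t, LineChart.germ_preimage_t, ← map_mul]
    exact (congrArg (φ.stalkMap x) (D.mul_germ (φ x) h₀ h₁)).trans (map_one _)
  mem₁ x h₀ hu := D.mem₁ (φ x) h₀ (by
    rw [LineChart.germ_preimage_t] at hu
    exact (isUnit_map_iff (φ.stalkMap x).hom _).mp hu)
  mem₀ x h₁ hu := D.mem₀ (φ x) h₁ (by
    rw [LineChart.germ_preimage_t] at hu
    exact (isUnit_map_iff (φ.stalkMap x).hom _).mp hu)

end LineChartPoints

theorem nonempty_projLineCharts {K : Type u} [Field K] {F : Scheme.{u}} {s : F ⟶ Spec (.of K)}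
    (h : Nonempty (Over.mk s ≅ projLine K)) : Nonempty (ProjLineCharts s) := by
  obtain ⟨e⟩ := h
  let φ : F ⟶ Proj (lineGrading K) := e.hom.left
  have hφ : φ ≫ lineStr K = s := Over.w e.hom
  have : IsIso φ := ⟨e.inv.left, by
    exact congrArg CommaMorphism.left e.hom_inv_id, by
    exact congrArg CommaMorphism.left e.inv_hom_id⟩
  exact ⟨(projLineCharts K).preimage φ hφ⟩

/-! ### Rational points of the projective line -/

section LineRationalPoints

open Polynomial

variable {K : Type u} [Field K] {F : Scheme.{u}} {s : F ⟶ Spec (.of K)}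

theorem value_eq_zero_iff (P : RationalPoint s) (u : F.presheaf.stalk P.1) :
    value s P u = 0 ↔ ¬ IsUnit u := by
  rw [← mem_nonunits_iff, ← IsLocalRing.mem_maximalIdeal]
  change (RingEquiv.ofBijective _ P.2).symm ((F.residue P.1).hom u) = 0 ↔ _
  rw [map_eq_zero_iff _ (RingEquiv.injective _)]
  exact IsLocalRing.residue_eq_zero_iff u

namespace LineChart

variable (c : LineChart s)

/-- The coordinate of a rational point. -/
def coord (P : RationalPoint s) (hP : P.1 ∈ c.U) : K :=
  value s P (F.presheaf.germ c.U P.1 hP c.t)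

theorem value_germ (P : RationalPoint s) (hP : P.1 ∈ c.U) (p : K[X]) :
    value s P (c.germ P.1 hP p) = p.eval (c.coord P hP) := by
  have : (value s P).comp (c.germ P.1 hP) = evalRingHom (c.coord P hP) := by
    apply Polynomial.ringHom_ext
    · intro a
      simp [value_scalarHom]
    · simp [coord]
  exact congrArg (fun φ => φ p) this

theorem isUnit_germ_iff_eval_ne_zero (P : RationalPoint s) (hP : P.1 ∈ c.U) (p : K[X]) :
    IsUnit (c.germ P.1 hP p) ↔ p.eval (c.coord P hP) ≠ 0 := by
  rw [← c.value_germ P hP, Ne, value_eq_zero_iff, not_not]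

theorem coord_injective {P Q : RationalPoint s} (hP : P.1 ∈ c.U) (hQ : Q.1 ∈ c.U)
    (h : c.coord P hP = c.coord Q hQ) : P = Q := by
  apply Subtype.ext
  refine ((c.specializes hP hQ fun p => ?_).antisymm (c.specializes hQ hP fun p => ?_)).eq <;>
  simp [isUnit_germ_iff_eval_ne_zero, h]

theorem residue_germ {x : F} (hx : x ∈ c.U) {a : K} (ha : ¬ IsUnit (c.germ x hx (X - C a)))
    (p : K[X]) : (F.residue x).hom (c.germ x hx p) = residueScalarHom s x (p.eval a) := by
  obtain ⟨r, hr⟩ := X_sub_C_dvd_sub_C_eval (a := a) (p := p)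
  have h0 : (F.residue x).hom (c.germ x hx (X - C a)) = 0 := by
    exact (IsLocalRing.residue_eq_zero_iff _).mpr ha
  have h1 := congrArg (fun p => (F.residue x).hom (c.germ x hx p)) hr
  simp only [map_mul, h0, zero_mul] at h1
  rw [map_sub, map_sub, sub_eq_zero, germ_C] at h1
  exact h1

theorem isRational {x : F} (hx : x ∈ c.U) {a : K} (ha : ¬ IsUnit (c.germ x hx (X - C a))) :
    Function.Bijective (residueScalarHom s x) := by
  refine ⟨(residueScalarHom s x).injective, fun z => ?_⟩
  obtain ⟨u, rfl⟩ := F.residue_surjective x z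
  obtain ⟨p, r, hr, h⟩ := c.exists_germ_mul_eq hx u
  have h1 := congrArg (F.residue x).hom h
  rw [map_mul, c.residue_germ hx ha, c.residue_germ hx ha] at h1
  have h2 : residueScalarHom s x (r.eval a) ≠ 0 := by
    rw [← c.residue_germ hx ha]
    exact (hr.map (F.residue x).hom).ne_zero
  refine ⟨p.eval a / r.eval a, ?_⟩
  rw [map_div₀, div_eq_iff h2]
  exact h1.symm

theorem coord_eq {P : RationalPoint s} (hP : P.1 ∈ c.U) {a : K}
    (ha : ¬ IsUnit (c.germ P.1 hP (X - C a))) : c.coord P hP = a := by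
  rw [isUnit_germ_iff_eval_ne_zero, not_not] at ha
  simpa [sub_eq_zero] using ha

theorem exists_coord_eq (a : K) : ∃ (P : RationalPoint s) (hP : P.1 ∈ c.U), c.coord P hP = a := by
  have : (Ideal.span {X - C a} : Ideal K[X]).IsPrime :=
    (Ideal.span_singleton_prime (X_sub_C_ne_zero a)).mpr (prime_X_sub_C a)
  obtain ⟨x, hx, h⟩ := c.exists_point (Ideal.span {X - C a})
  have ha : ¬ IsUnit (c.germ x hx (X - C a)) := by
    rw [h, not_not]; exact Ideal.mem_span_singleton_self _
  exact ⟨⟨x, c.isRational hx ha⟩, hx, c.coord_eq (P := ⟨x, c.isRational hx ha⟩) hx ha⟩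

theorem span_germ_eq (P : RationalPoint s) (hP : P.1 ∈ c.U) :
    Ideal.span {c.germ P.1 hP (X - C (c.coord P hP))} =
      IsLocalRing.maximalIdeal (F.presheaf.stalk P.1) := by
  apply le_antisymm
  · rw [Ideal.span_singleton_le_iff_mem, IsLocalRing.mem_maximalIdeal, mem_nonunits_iff,
      isUnit_germ_iff_eval_ne_zero]
    simp
  · intro u hu
    rw [IsLocalRing.mem_maximalIdeal, mem_nonunits_iff, ← value_eq_zero_iff] at hu
    obtain ⟨p, r, hr, h⟩ := c.exists_germ_mul_eq hP u
    have h1 := congrArg (value s P) h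
    rw [map_mul, hu, zero_mul, c.value_germ, eq_comm] at h1
    obtain ⟨v, hv⟩ := dvd_iff_isRoot.mpr h1
    rw [Ideal.mem_span_singleton, ← hr.dvd_mul_right, h, hv, map_mul]
    exact dvd_mul_right _ _

theorem genericPoint_mem [IsIntegral F] : genericPoint F ∈ c.U := by
  obtain ⟨P, hP, -⟩ := c.exists_coord_eq 0
  exact ((genericPoint_spec F).mem_open_set_iff c.U.isOpen).mpr ⟨P.1, trivial, hP⟩

/-- A polynomial in the coordinate as a rational function. -/
def toFunctionField [IsIntegral F] : K[X] →+* F.functionField :=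
  c.germ (genericPoint F) c.genericPoint_mem

theorem algebraMap_germ [IsIntegral F] {x : F} (hx : x ∈ c.U) (p : K[X]) :
    algebraMap (F.presheaf.stalk x) F.functionField (c.germ x hx p) = c.toFunctionField p := by
  have h := F.presheaf.germ_stalkSpecializes hx
    ((genericPoint_spec F).specializes (trivial : x ∈ (Set.univ : Set F)))
  exact congrArg (fun φ => φ.hom (c.equiv p)) h

theorem toFunctionField_injective [IsIntegral F] : Function.Injective c.toFunctionField :=
  c.germ_injective _

theorem exists_toFunctionField_eq [IsIntegral F] {ψ : F.functionField}
    (h : ∀ x ∈ c.U, ∃ v : F.presheaf.stalk x, algebraMap _ F.functionField v = ψ) :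
    ∃ p, c.toFunctionField p = ψ := by
  let I : Ideal K[X] :=
    { carrier := {r | ∃ p, c.toFunctionField p = ψ * c.toFunctionField r}
      zero_mem' := ⟨0, by simp⟩
      add_mem' := by
        rintro r r' ⟨p, hp⟩ ⟨p', hp'⟩
        exact ⟨p + p', by rw [map_add, map_add, hp, hp', mul_add]⟩
      smul_mem' := by
        rintro w r ⟨p, hp⟩
        exact ⟨w * p, by rw [smul_eq_mul, map_mul, map_mul, hp]; ring⟩ }
  have hI : I = ⊤ := by
    by_contra hI
    obtain ⟨𝔪, h𝔪, hle⟩ := Ideal.exists_le_maximal I hI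
    have := h𝔪.isPrime
    obtain ⟨x, hx, hpt⟩ := c.exists_point 𝔪
    obtain ⟨v, hv⟩ := h x hx
    obtain ⟨p, r, hr, hpr⟩ := c.exists_germ_mul_eq hx v
    refine (hpt r).mp hr (hle ⟨p, ?_⟩)
    rw [← c.algebraMap_germ hx, ← c.algebraMap_germ hx, ← hpr, map_mul, hv]
  obtain ⟨p, hp⟩ : (1 : K[X]) ∈ I := hI ▸ trivial
  exact ⟨p, by simpa using hp⟩

end LineChart

namespace ProjLineCharts

variable (D : ProjLineCharts s)

theorem coord_eq_zero_of_notMem {P : RationalPoint s} (hP : P.1 ∈ D.c₁.U) (h : P.1 ∉ D.c₀.U) :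
    D.c₁.coord P hP = 0 := by
  rw [LineChart.coord, value_eq_zero_iff]
  exact fun hu => h (D.mem₀ P.1 hP hu)

theorem exists_notMem : ∃ (P : RationalPoint s) (hP : P.1 ∈ D.c₁.U),
    D.c₁.coord P hP = 0 ∧ P.1 ∉ D.c₀.U := by
  obtain ⟨P, hP, h⟩ := D.c₁.exists_coord_eq 0
  refine ⟨P, hP, h, fun hP₀ => ?_⟩
  rw [LineChart.coord, value_eq_zero_iff] at h
  exact h (IsUnit.of_mul_eq_one_right _ (D.mul_germ P.1 hP₀ hP))

theorem eq_of_notMem {P Q : RationalPoint s} (hP : P.1 ∉ D.c₀.U) (hQ : Q.1 ∉ D.c₀.U) : P = Q := by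
  have hP' := (D.cover P.1).resolve_left hP
  have hQ' := (D.cover Q.1).resolve_left hQ
  exact D.c₁.coord_injective hP' hQ' (by
    rw [D.coord_eq_zero_of_notMem hP' hP, D.coord_eq_zero_of_notMem hQ' hQ])

theorem card_rationalPoint (D : ProjLineCharts s) [Finite K] :
    Nat.card (RationalPoint s) = Nat.card K + 1 := by
  classical
  let φ : RationalPoint s → Option K := fun P =>
    if hP : P.1 ∈ D.c₀.U then some (D.c₀.coord P hP) else none
  have hφ : Function.Bijective φ := by
    constructor
    · intro P Q h
      by_cases hP : P.1 ∈ D.c₀.U <;> by_cases hQ : Q.1 ∈ D.c₀.U <;>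
        simp only [φ, hP, hQ, dif_pos, dif_neg, not_false_eq_true, Option.some.injEq,
          reduceCtorEq] at h
      · exact D.c₀.coord_injective hP hQ h
      · exact D.eq_of_notMem hP hQ
    · rintro (_ | a)
      · obtain ⟨P, -, -, hP⟩ := D.exists_notMem
        exact ⟨P, dif_neg hP⟩
      · obtain ⟨P, hP, rfl⟩ := D.c₀.exists_coord_eq a
        exact ⟨P, dif_pos hP⟩
  rw [Nat.card_eq_of_bijective φ hφ, Finite.card_option]

end ProjLineCharts

end LineRationalPoints

/-! ### Zeros of sections on the projective line -/

theorem map_units_zpow {R L : Type*} [CommRing R] [Field L] (φ : R →+* L) (w : Rˣ) (n : ℤ) :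
    φ ((w ^ n : Rˣ) : R) = φ w ^ n := by
  have h : Units.map φ.toMonoidHom (w ^ n) = Units.map φ.toMonoidHom w ^ n := map_zpow _ _ _
  have h' := congrArg Units.val h
  rwa [Units.val_zpow_eq_zpow_val] at h'

section LineZeros

open Polynomial

variable {K : Type u} [Field K] {F : Scheme.{u}} {s : F ⟶ Spec (.of K)}

namespace LineChart

variable (c : LineChart s)

theorem isUnit_germ_X_sub_C_coord {x : F} (hx : x ∈ c.U) {P : RationalPoint s} (hP : P.1 ∈ c.U)
    (h : x ≠ P.1) : IsUnit (c.germ x hx (X - C (c.coord P hP))) := by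
  by_contra hn
  let Q : RationalPoint s := ⟨x, c.isRational hx hn⟩
  exact h (congrArg Subtype.val (c.coord_injective (P := Q) hx hP (c.coord_eq (P := Q) hx hn)))

theorem encard_eval_coord_eq_zero_le {p : K[X]} (hp : p ≠ 0) :
    {P : RationalPoint s | ∃ hP : P.1 ∈ c.U, p.eval (c.coord P hP) = 0}.encard ≤ p.natDegree := by
  classical
  let φ : RationalPoint s → K := fun P => if hP : P.1 ∈ c.U then c.coord P hP else 0
  have hφ (P : RationalPoint s) (hP : P.1 ∈ c.U) : φ P = c.coord P hP := dif_pos hP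
  have hinj : Set.InjOn φ {P | ∃ hP : P.1 ∈ c.U, p.eval (c.coord P hP) = 0} := by
    rintro P ⟨hP, -⟩ Q ⟨hQ, -⟩ h
    exact c.coord_injective hP hQ (by rwa [hφ P hP, hφ Q hQ] at h)
  have hmaps : φ '' {P | ∃ hP : P.1 ∈ c.U, p.eval (c.coord P hP) = 0} ⊆ p.roots.toFinset := by
    rintro _ ⟨P, ⟨hP, h⟩, rfl⟩
    simpa [hφ P hP, hp] using h
  rw [← hinj.encard_image]
  refine (Set.encard_le_encard hmaps).trans ?_
  rw [Set.encard_coe_eq_coe_finsetCard]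
  exact_mod_cast (Multiset.toFinset_card_le _).trans (card_roots' p)

variable [IsIntegral F]

theorem toFunctionField_X_ne_zero : c.toFunctionField X ≠ 0 :=
  (map_ne_zero_iff _ c.toFunctionField_injective).mpr X_ne_zero

theorem nonneg_of_algebraMap_eq_zpow_mul {P : RationalPoint s} (hP : P.1 ∈ c.U)
    (h0 : c.coord P hP = 0) {m : ℤ} {u : F.presheaf.stalk P.1} (ω : (F.presheaf.stalk P.1)ˣ)
    (h : algebraMap _ F.functionField u =
      c.toFunctionField X ^ m * algebraMap (F.presheaf.stalk P.1) _ ω) : 0 ≤ m := by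
  by_contra! hm
  obtain ⟨n, rfl⟩ := Int.exists_eq_neg_ofNat hm.le
  have hX : ¬ IsUnit (c.germ P.1 hP X) := by
    rw [c.isUnit_germ_iff_eval_ne_zero, h0, eval_X, not_not]
  have hdvd : c.germ P.1 hP X ^ n * u = ω := by
    apply IsFractionRing.injective (F.presheaf.stalk P.1) F.functionField
    rw [map_mul, map_pow, c.algebraMap_germ hP, h, zpow_neg, zpow_natCast,
      mul_inv_cancel_left₀ (pow_ne_zero n c.toFunctionField_X_ne_zero)]
  exact hX (isUnit_of_dvd_unit ((dvd_pow_self _ (by omega)).trans (Dvd.intro _ hdvd)) ω.isUnit)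

theorem pos_of_algebraMap_eq_zpow_mul {P : RationalPoint s} (hP : P.1 ∈ c.U)
    (h0 : c.coord P hP = 0) {m : ℤ} {u : F.presheaf.stalk P.1} (hu : ¬ IsUnit u)
    (ω : (F.presheaf.stalk P.1)ˣ)
    (h : algebraMap _ F.functionField u =
      c.toFunctionField X ^ m * algebraMap (F.presheaf.stalk P.1) _ ω) : 0 < m := by
  refine (c.nonneg_of_algebraMap_eq_zpow_mul hP h0 ω h).lt_of_ne ?_
  rintro rfl
  rw [zpow_zero, one_mul] at h
  exact hu (IsFractionRing.injective (F.presheaf.stalk P.1) F.functionField h ▸ ω.isUnit)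

theorem exists_unit_algebraMap_eq {x₀ : RationalPoint s} (hx₀ : x₀.1 ∈ c.U)
    {g : F.presheaf.stalk x₀.1}
    (hg : Ideal.span {g} = IsLocalRing.maximalIdeal (F.presheaf.stalk x₀.1))
    {ψ : F.functionField} {b : ℤ} {u : ∀ x : F, F.presheaf.stalk x}
    (hu : ∀ x, x ≠ x₀.1 → algebraMap _ F.functionField (u x) = ψ)
    (hu₀ : algebraMap _ F.functionField (u x₀.1) = ψ * algebraMap _ F.functionField g ^ b)
    {x : F} (hx : x ∈ c.U) :
    ∃ w : (F.presheaf.stalk x)ˣ, algebraMap _ F.functionField (u x * w) =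
      ψ * c.toFunctionField (X - C (c.coord x₀ hx₀)) ^ b := by
  by_cases hxx : x = x₀.1
  · subst hxx
    obtain ⟨w, hw⟩ : Associated g (c.germ x₀.1 hx₀ (X - C (c.coord x₀ hx₀))) := by
      rw [← Ideal.span_singleton_eq_span_singleton, hg, c.span_germ_eq]
    refine ⟨w ^ b, ?_⟩
    rw [map_mul, hu₀, map_units_zpow, ← c.algebraMap_germ hx₀, ← hw, map_mul, mul_zpow, mul_assoc]
  · obtain ⟨w, hw⟩ := c.isUnit_germ_X_sub_C_coord hx hx₀ hxx
    refine ⟨w ^ b, ?_⟩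
    rw [map_mul, hu x hxx, map_units_zpow, ← c.algebraMap_germ hx, ← hw]

theorem exists_polynomial_eq {x₀ : RationalPoint s} (hx₀ : x₀.1 ∈ c.U)
    {g : F.presheaf.stalk x₀.1}
    (hg : Ideal.span {g} = IsLocalRing.maximalIdeal (F.presheaf.stalk x₀.1))
    {ψ : F.functionField} (hψ : ψ ≠ 0) {b : ℤ} {u : ∀ x : F, F.presheaf.stalk x}
    (hu : ∀ x, x ≠ x₀.1 → algebraMap _ F.functionField (u x) = ψ)
    (hu₀ : algebraMap _ F.functionField (u x₀.1) = ψ * algebraMap _ F.functionField g ^ b) :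
    ∃ p : K[X], p ≠ 0 ∧
      c.toFunctionField p = ψ * c.toFunctionField (X - C (c.coord x₀ hx₀)) ^ b ∧
      ∀ {P : RationalPoint s} (hP : P.1 ∈ c.U), ¬ IsUnit (u P.1) → p.eval (c.coord P hP) = 0 := by
  have hreg {x : F} (hx : x ∈ c.U) := c.exists_unit_algebraMap_eq hx₀ hg hu hu₀ hx
  obtain ⟨p, hp⟩ := c.exists_toFunctionField_eq fun x hx => (hreg hx).imp' _ fun _ => id
  refine ⟨p, ?_, hp, fun {P} hP hPu => ?_⟩
  · rintro rfl
    rw [map_zero, zero_eq_mul] at hp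
    exact hp.elim hψ (zpow_ne_zero b
      ((map_ne_zero_iff _ c.toFunctionField_injective).mpr (X_sub_C_ne_zero _)))
  · obtain ⟨w, hw⟩ := hreg hP
    rw [← hp, ← c.algebraMap_germ hP] at hw
    have huw := IsFractionRing.injective (F.presheaf.stalk P.1) F.functionField hw
    by_contra hne
    rw [← Ne, ← c.isUnit_germ_iff_eval_ne_zero P hP, ← huw] at hne
    exact hPu (isUnit_of_mul_isUnit_left hne)

end LineChart

namespace ProjLineCharts

theorem toFunctionField_mul_inv [IsIntegral F] (D : ProjLineCharts s) :
    D.c₀.toFunctionField X * D.c₁.toFunctionField X = 1 := by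
  simp only [LineChart.toFunctionField, LineChart.germ_X]
  exact D.mul_germ _ _ _

theorem toFunctionField_C [IsIntegral F] (D : ProjLineCharts s) (a : K) :
    D.c₀.toFunctionField (C a) = D.c₁.toFunctionField (C a) := by
  simp only [LineChart.toFunctionField, LineChart.germ_C]

theorem toFunctionField_eq_reverse [IsIntegral F] (D : ProjLineCharts s) (p : K[X]) :
    D.c₀.toFunctionField p =
      D.c₁.toFunctionField p.reverse * D.c₀.toFunctionField X ^ p.natDegree := by
  have hinv : Invertible (D.c₀.toFunctionField X) :=
    ⟨D.c₁.toFunctionField X, by rw [mul_comm]; exact D.toFunctionField_mul_inv,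
      D.toFunctionField_mul_inv⟩
  have h := eval₂_reverse_mul_pow (D.c₀.toFunctionField.comp C) (D.c₀.toFunctionField X) p
  have h0 (q : K[X]) : eval₂ (D.c₀.toFunctionField.comp C) (D.c₀.toFunctionField X) q =
      D.c₀.toFunctionField q := by
    rw [← hom_eval₂, eval₂_C_X]
  have hi : ⅟(D.c₀.toFunctionField X) = D.c₁.toFunctionField X :=
    invOf_eq_right_inv D.toFunctionField_mul_inv
  have h1 (q : K[X]) : eval₂ (D.c₀.toFunctionField.comp C) (D.c₁.toFunctionField X) q =
      D.c₁.toFunctionField q := by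
    have : D.c₀.toFunctionField.comp C = D.c₁.toFunctionField.comp C :=
      RingHom.ext D.toFunctionField_C
    rw [this, ← hom_eval₂, eval₂_C_X]
  rw [hi, h1, h0] at h
  exact h.symm

theorem exists_unit_toFunctionField_eq [IsIntegral F] (D : ProjLineCharts s) {p : K[X]}
    (hp : p ≠ 0) {Q : RationalPoint s} (hQ : Q.1 ∈ D.c₁.U) (hQ0 : D.c₁.coord Q hQ = 0) :
    ∃ w : (F.presheaf.stalk Q.1)ˣ, D.c₀.toFunctionField p =
      algebraMap (F.presheaf.stalk Q.1) _ w * D.c₁.toFunctionField X ^ (-p.natDegree : ℤ) := by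
  have hrev : IsUnit (D.c₁.germ Q.1 hQ p.reverse) := by
    rw [LineChart.isUnit_germ_iff_eval_ne_zero, hQ0, ← coeff_zero_eq_eval_zero, coeff_zero_reverse]
    exact leadingCoeff_ne_zero.mpr hp
  obtain ⟨w, hw⟩ := hrev
  refine ⟨w, ?_⟩
  rw [hw, D.c₁.algebraMap_germ hQ, zpow_neg, ← inv_zpow, zpow_natCast,
    ← eq_inv_of_mul_eq_one_left D.toFunctionField_mul_inv]
  exact D.toFunctionField_eq_reverse p

/-- The order at infinity of a section of `𝒪(b x₀)` in terms of its polynomial in the chart `c₀`. -/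
theorem exists_unit_algebraMap_eq_zpow_mul [IsIntegral F] (D : ProjLineCharts s) {p : K[X]}
    (hp : p ≠ 0) {Q : RationalPoint s} (hQ : Q.1 ∈ D.c₁.U) (hQ0 : D.c₁.coord Q hQ = 0)
    {ψ : F.functionField} {a : K} {b : ℤ}
    (h : D.c₀.toFunctionField p = ψ * D.c₀.toFunctionField (X - C a) ^ b) :
    ∃ ω : (F.presheaf.stalk Q.1)ˣ, ψ =
      D.c₁.toFunctionField X ^ (b - p.natDegree) * algebraMap (F.presheaf.stalk Q.1) _ ω := by
  have hℓ0 : D.c₀.toFunctionField (X - C a) ≠ 0 :=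
    (map_ne_zero_iff _ D.c₀.toFunctionField_injective).mpr (X_sub_C_ne_zero a)
  obtain ⟨v, hv⟩ := D.exists_unit_toFunctionField_eq hp hQ hQ0
  obtain ⟨w, hw⟩ := D.exists_unit_toFunctionField_eq (X_sub_C_ne_zero a) hQ hQ0
  refine ⟨v * w ^ (-b), ?_⟩
  have hT0 := D.c₁.toFunctionField_X_ne_zero
  rw [(eq_mul_inv_iff_mul_eq₀ (zpow_ne_zero b hℓ0)).mpr h.symm, hv, hw, natDegree_X_sub_C,
    Units.val_mul, map_mul, map_units_zpow, mul_zpow, ← zpow_mul, mul_inv, ← zpow_neg, ← zpow_neg,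
    sub_eq_neg_add, zpow_add₀ hT0]
  simp only [Nat.cast_one, neg_mul, one_mul, neg_neg]
  ring

theorem zeros_le_of_mem [IsIntegral F] (D : ProjLineCharts s) (x₀ : RationalPoint s)
    (hx₀ : x₀.1 ∈ D.c₀.U) (g : F.presheaf.stalk x₀.1)
    (hg : Ideal.span {g} = IsLocalRing.maximalIdeal (F.presheaf.stalk x₀.1))
    (ψ : F.functionField) (hψ : ψ ≠ 0) (b : ℤ) (u : ∀ x : F, F.presheaf.stalk x)
    (hu : ∀ x, x ≠ x₀.1 → algebraMap _ F.functionField (u x) = ψ)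
    (hu₀ : algebraMap _ F.functionField (u x₀.1) = ψ * algebraMap _ F.functionField g ^ b) :
    0 ≤ b ∧ {P : RationalPoint s | ¬ IsUnit (u P.1)}.encard ≤ b.toNat := by
  obtain ⟨p, hp0, hp, hroot⟩ := D.c₀.exists_polynomial_eq hx₀ hg hψ hu hu₀
  obtain ⟨Q, hQ, hQ0, hQn⟩ := D.exists_notMem
  obtain ⟨ω, hω⟩ := D.exists_unit_algebraMap_eq_zpow_mul hp0 hQ hQ0 hp
  rw [← hu Q.1 fun h => hQn (h ▸ hx₀)] at hω
  have hdeg := D.c₁.nonneg_of_algebraMap_eq_zpow_mul hQ hQ0 ω hω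
  refine ⟨by omega, ?_⟩
  have hzeros := D.c₀.encard_eval_coord_eq_zero_le hp0
  by_cases hQu : IsUnit (u Q.1)
  · refine (Set.encard_le_encard fun P hP => ?_).trans (hzeros.trans ?_)
    · have hP₀ : P.1 ∈ D.c₀.U := by
        by_contra hn
        exact hP (D.eq_of_notMem hn hQn ▸ hQu)
      exact ⟨hP₀, hroot hP₀ hP⟩
    · exact_mod_cast (by omega : p.natDegree ≤ b.toNat)
  · have hdeg' := D.c₁.pos_of_algebraMap_eq_zpow_mul hQ hQ0 hQu ω hω
    have hsub : {P : RationalPoint s | ¬ IsUnit (u P.1)} ⊆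
        insert Q {P | ∃ hP : P.1 ∈ D.c₀.U, p.eval (D.c₀.coord P hP) = 0} := fun P hP => by
      by_cases hn : P.1 ∈ D.c₀.U
      · exact .inr ⟨hn, hroot hn hP⟩
      · exact .inl (D.eq_of_notMem hn hQn)
    refine (Set.encard_le_encard hsub).trans ((Set.encard_insert_le _ _).trans ?_)
    refine (add_le_add_left hzeros 1).trans ?_
    exact_mod_cast (by omega : p.natDegree + 1 ≤ b.toNat)

theorem zeros_le [IsIntegral F] (D : ProjLineCharts s) (x₀ : RationalPoint s)
    (g : F.presheaf.stalk x₀.1)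
    (hg : Ideal.span {g} = IsLocalRing.maximalIdeal (F.presheaf.stalk x₀.1))
    (ψ : F.functionField) (hψ : ψ ≠ 0) (b : ℤ) (u : ∀ x : F, F.presheaf.stalk x)
    (hu : ∀ x, x ≠ x₀.1 → algebraMap _ F.functionField (u x) = ψ)
    (hu₀ : algebraMap _ F.functionField (u x₀.1) = ψ * algebraMap _ F.functionField g ^ b) :
    0 ≤ b ∧ {P : RationalPoint s | ¬ IsUnit (u P.1)}.encard ≤ b.toNat :=
  (D.cover x₀.1).elim (fun h => D.zeros_le_of_mem x₀ h g hg ψ hψ b u hu hu₀)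
    (fun h => D.swap.zeros_le_of_mem x₀ h g hg ψ hψ b u hu hu₀)

theorem exists_span_eq_maximalIdeal [IsIntegral F] (D : ProjLineCharts s) (x₀ : RationalPoint s) :
    ∃ g : F.presheaf.stalk x₀.1, g ≠ 0 ∧
      Ideal.span {g} = IsLocalRing.maximalIdeal (F.presheaf.stalk x₀.1) := by
  have key (c : LineChart s) (h : x₀.1 ∈ c.U) : ∃ g : F.presheaf.stalk x₀.1, g ≠ 0 ∧
      Ideal.span {g} = IsLocalRing.maximalIdeal (F.presheaf.stalk x₀.1) :=
    ⟨_, (map_ne_zero_iff _ (c.germ_injective h)).mpr (X_sub_C_ne_zero _), c.span_germ_eq x₀ h⟩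
  exact (D.cover x₀.1).elim (key _) (key _)

end ProjLineCharts

end LineZeros

/-! ### Scalars, rational points and fibres -/

section Scalars

variable {k : Type u} [Field k]

theorem stalkMap_scalarHom {X Y : Scheme.{u}} (φ : Y ⟶ X) (s : X ⟶ Spec (.of k)) (y : Y) (c : k) :
    φ.stalkMap y (scalarHom s (φ y) c) = scalarHom (φ ≫ s) y c := by
  simp only [scalarHom, CommRingCat.hom_comp, RingHom.comp_apply, Scheme.Hom.comp_appTop]
  exact φ.germ_stalkMap_apply ⊤ y trivial _

theorem residueFieldMap_residueScalarHom {X Y : Scheme.{u}} (φ : Y ⟶ X) (s : X ⟶ Spec (.of k))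
    (y : Y) (c : k) :
    φ.residueFieldMap y (residueScalarHom s (φ y) c) = residueScalarHom (φ ≫ s) y c := by
  have h := congrArg (fun ψ => ψ.hom (scalarHom s (φ y) c)) (Scheme.residue_residueFieldMap φ y)
  simp only [CommRingCat.hom_comp, RingHom.comp_apply] at h
  refine h.trans ?_
  exact congrArg (Y.residue y).hom (stalkMap_scalarHom φ s y c)

theorem scalarHom_comp_specMap {K : Type u} [Field K] {X : Scheme.{u}} (s : X ⟶ Spec (.of K))
    (θ : k →+* K) (x : X) (c : k) :
    scalarHom (s ≫ Spec.map (CommRingCat.ofHom θ)) x c = scalarHom s x (θ c) := by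
  have h := congrArg (fun ψ => ψ.hom c) (Scheme.ΓSpecIso_inv_naturality (CommRingCat.ofHom θ))
  simp only [CommRingCat.hom_comp, RingHom.comp_apply] at h
  simp only [scalarHom, CommRingCat.hom_comp, RingHom.comp_apply, Scheme.Hom.comp_appTop]
  exact congrArg _ (congrArg _ h.symm)

theorem residueScalarHom_comp_specMap {K : Type u} [Field K] {X : Scheme.{u}}
    (s : X ⟶ Spec (.of K)) (θ : k →+* K) (x : X) (c : k) :
    residueScalarHom (s ≫ Spec.map (CommRingCat.ofHom θ)) x c = residueScalarHom s x (θ c) :=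
  congrArg (X.residue x).hom (scalarHom_comp_specMap s θ x c)

theorem fromSpecResidueField_comp {X : Scheme.{u}} (s : X ⟶ Spec (.of k)) (x : X) :
    X.fromSpecResidueField x ≫ s = Spec.map (CommRingCat.ofHom (residueScalarHom s x)) := by
  have h : X.fromSpecStalk x ≫ s = Spec.map (CommRingCat.ofHom (scalarHom s x)) := by
    apply ext_of_isAffine
    rw [← cancel_epi (Scheme.ΓSpecIso (.of k)).inv, ← Scheme.ΓSpecIso_inv_naturality,
      Scheme.Hom.comp_appTop, Scheme.fromSpecStalk_appTop]
    simp [scalarHom]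
  rw [Scheme.fromSpecResidueField, Category.assoc, h, ← Spec.map_comp]
  rfl

theorem scalarHom_id_surjective {K : Type u} [Field K] (x : (Spec (.of K) : Scheme.{u})) :
    Function.Surjective (scalarHom (𝟙 (Spec (.of K))) x) := by
  intro u
  obtain ⟨a, b, hb, h⟩ := exists_germ_mul_eq (isAffineOpen_top (Spec (.of K)))
    (TopologicalSpace.Opens.mem_top x) u
  let e := (Scheme.ΓSpecIso (.of K)).commRingCatIsoToRingEquiv
  have hs (c : K) : scalarHom (𝟙 (Spec (.of K))) x c =
      (Spec (.of K)).presheaf.germ ⊤ x (TopologicalSpace.Opens.mem_top x) (e.symm c) := by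
    simp only [scalarHom, Scheme.Hom.id_appTop, Category.id_comp, CommRingCat.hom_comp,
      RingHom.comp_apply]
    rfl
  have hb0 : e b ≠ 0 := by
    intro h0
    rw [map_eq_zero_iff _ e.injective] at h0
    rw [h0, map_zero] at hb
    exact not_isUnit_zero hb
  refine ⟨e a / e b, hb.mul_right_cancel ?_⟩
  rw [h, ← e.symm_apply_apply b, ← hs, ← map_mul, e.symm_apply_apply, ← e.symm_apply_apply a, ← hs,
    div_mul_cancel₀ _ hb0, e.symm_apply_apply]

theorem bijective_residueScalarHom_id {K : Type u} [Field K] (x : (Spec (.of K) : Scheme.{u})) :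
    Function.Bijective (residueScalarHom (𝟙 (Spec (.of K))) x) := by
  refine ⟨(residueScalarHom (𝟙 (Spec (.of K))) x).injective, fun z => ?_⟩
  obtain ⟨u, rfl⟩ := (Spec (.of K)).residue_surjective x z
  obtain ⟨c, rfl⟩ := scalarHom_id_surjective x u
  exact ⟨c, rfl⟩

theorem maximalIdeal_stalk_spec_field {K : Type u} [Field K] (x : (Spec (.of K) : Scheme.{u})) :
    IsLocalRing.maximalIdeal ((Spec (.of K)).presheaf.stalk x) = ⊥ := by
  rw [eq_bot_iff]
  intro u hu
  obtain ⟨c, rfl⟩ := scalarHom_id_surjective x u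
  by_cases hc : c = 0
  · simp [hc]
  · exact absurd ((isUnit_iff_ne_zero.mpr hc).map (scalarHom (𝟙 (Spec (.of K))) x)) hu

theorem isRational_of_section {K : Type u} [Field K] {F : Scheme.{u}} (s : F ⟶ Spec (.of K))
    (τ : Spec (.of K) ⟶ F) (h : τ ≫ s = 𝟙 _) (x : (Spec (.of K) : Scheme.{u})) :
    Function.Bijective (residueScalarHom s (τ x)) := by
  refine ⟨(residueScalarHom s (τ x)).injective, fun z => ?_⟩
  obtain ⟨c, hc⟩ := (bijective_residueScalarHom_id x).2 (τ.residueFieldMap x z)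
  refine ⟨c, (τ.residueFieldMap x).hom.injective ?_⟩
  rw [← hc, ← h]
  exact residueFieldMap_residueScalarHom τ s x c

end Scalars

section LocalPoints

theorem stalkClosedPointTo_eq_zero {F : Scheme.{u}} {A : CommRingCat.{u}} [IsLocalRing A]
    (l : Spec A ⟶ F) {U : F.Opens} (hU : l (IsLocalRing.closedPoint A) ∈ U) {x : F} (hx : x ∈ U)
    (hlx : l (IsLocalRing.closedPoint A) = x) {τ : Γ(F, U)} (hτ : F.presheaf.germ U x hx τ = 0) :
    Scheme.stalkClosedPointTo l (F.presheaf.germ U _ hU τ) = 0 := by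
  subst hlx
  exact (congrArg (Scheme.stalkClosedPointTo l) hτ).trans (map_zero _)

theorem eq_zero_of_stalkMap_eq_zero {F X : Scheme.{u}} {ι : F ⟶ X} (hι : Function.Injective ι)
    {x : F} {A : CommRingCat.{u}} [IsLocalRing A] (m : X.presheaf.stalk (ι x) ⟶ A)
    [IsLocalHom m.hom] {l : Spec A ⟶ F} (hl : l ≫ ι = Spec.map m ≫ X.fromSpecStalk (ι x))
    {u : X.presheaf.stalk (ι x)} (hu : ι.stalkMap x u = 0) : m u = 0 := by
  obtain ⟨U, hU, σ, rfl⟩ := X.presheaf.exists_germ_eq u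
  rw [Scheme.Hom.germ_stalkMap_apply] at hu
  have ha : (Spec.map m ≫ X.fromSpecStalk (ι x)) (IsLocalRing.closedPoint A) = ι x :=
    (Scheme.Hom.comp_apply _ _ _).trans
      ((congrArg _ Spec_closedPoint).trans Scheme.fromSpecStalk_closedPoint)
  have hlx : l (IsLocalRing.closedPoint A) = x := by
    apply hι
    rw [← ha, ← hl]
    rfl
  have hzero {f : Spec A ⟶ X} (hf : f = l ≫ ι) (hfU : f (IsLocalRing.closedPoint A) ∈ U) :
      Scheme.stalkClosedPointTo f (X.presheaf.germ U _ hfU σ) = 0 := by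
    subst hf
    rw [Scheme.stalkClosedPointTo_comp]
    exact (congrArg (Scheme.stalkClosedPointTo l) (ι.germ_stalkMap_apply U _ hfU σ)).trans
      (stalkClosedPointTo_eq_zero l hfU hU hlx hu)
  exact (congrArg (fun ψ => ψ.hom σ) (Scheme.germ_stalkClosedPointTo_Spec_fromSpecStalk m U
    (ha.symm ▸ hU))).symm.trans (hzero hl.symm _)

theorem exists_comp_fromSpecResidueField {X C : Scheme.{u}} (π : X ⟶ C) {x : X}
    {A : CommRingCat.{u}} (m : X.presheaf.stalk x ⟶ A)
    (hm : ∀ r ∈ IsLocalRing.maximalIdeal (C.presheaf.stalk (π x)), m (π.stalkMap x r) = 0)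
    {y : C} (hy : π x = y) : ∃ b : Spec A ⟶ Spec (C.residueField y),
      (Spec.map m ≫ X.fromSpecStalk x) ≫ π = b ≫ C.fromSpecResidueField y := by
  subst hy
  let l : C.residueField (π x) ⟶ A :=
    CommRingCat.ofHom (Ideal.Quotient.lift _ (π.stalkMap x ≫ m).hom hm)
  have hl : C.residue (π x) ≫ l = π.stalkMap x ≫ m := by
    ext r
    exact Ideal.Quotient.lift_mk _ (π.stalkMap x ≫ m).hom hm
  refine ⟨Spec.map l, ?_⟩
  rw [Scheme.fromSpecResidueField, ← Spec.map_comp_assoc, hl, Spec.map_comp, Category.assoc,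
    Category.assoc, Scheme.SpecMap_stalkMap_fromSpecStalk]

end LocalPoints

section Fiber

variable {X C : Scheme.{u}} (π : X ⟶ C) (y : C)

/-- The structure morphism of a fibre. -/
abbrev fiberStr : π.fiber y ⟶ Spec (.of (C.residueField y)) := π.fiberToSpecResidueField y

theorem fiberι_apply (x : π.fiber y) : π (π.fiberι y x) = y := by
  have : π.fiberι y x ∈ π ⁻¹' {y} := by
    rw [← π.range_fiberι y]; exact ⟨x, rfl⟩
  exact this

theorem exists_fiberι_eq {x : X} (h : π x = y) : ∃ z : π.fiber y, π.fiberι y z = x := by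
  have : x ∈ Set.range (π.fiberι y) := by rw [π.range_fiberι y]; exact h
  exact this

theorem stalkMap_eq_zero_of_fac {F : Scheme.{u}} {K : Type u} [Field K] {f : F ⟶ C}
    {p : F ⟶ Spec (.of K)} {r : Spec (.of K) ⟶ C} (h : f = p ≫ r) (x : F)
    (a : C.presheaf.stalk (f x)) (ha : a ∈ IsLocalRing.maximalIdeal (C.presheaf.stalk (f x))) :
    f.stalkMap x a = 0 := by
  subst h
  have h1 : r.stalkMap (p x) a ∈
      IsLocalRing.maximalIdeal ((Spec (.of K)).presheaf.stalk (p x)) :=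
    IsLocalRing.map_maximalIdeal_le (r.stalkMap (p x)).hom (Ideal.mem_map_of_mem _ ha)
  rw [maximalIdeal_stalk_spec_field, Ideal.mem_bot] at h1
  rw [Scheme.Hom.stalkMap_comp]
  exact (congrArg (p.stalkMap x) h1).trans (map_zero _)

theorem fiberι_stalkMap_eq_zero (x : π.fiber y) (a : C.presheaf.stalk (π (π.fiberι y x)))
    (ha : a ∈ IsLocalRing.maximalIdeal (C.presheaf.stalk (π (π.fiberι y x)))) :
    (π.fiberι y).stalkMap x (π.stalkMap (π.fiberι y x) a) = 0 := by
  have h := stalkMap_eq_zero_of_fac (f := π.fiberι y ≫ π) (p := fiberStr π y) (π.fiber_fac y) x a ha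
  rw [Scheme.Hom.stalkMap_comp] at h
  exact h

variable {k : Type u} [Field k] {strX : X ⟶ Spec (.of k)} {strC : C ⟶ Spec (.of k)}

theorem residueScalarHom_fiberι (hπ : π ≫ strC = strX) (x : π.fiber y) (c : k) :
    (π.fiberι y).residueFieldMap x (residueScalarHom strX (π.fiberι y x) c) =
      residueScalarHom (fiberStr π y) x (residueScalarHom strC y c) := by
  rw [residueFieldMap_residueScalarHom, ← hπ, ← Category.assoc, π.fiber_fac, Category.assoc,
    fromSpecResidueField_comp]
  exact residueScalarHom_comp_specMap (fiberStr π y) _ x c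

theorem bijective_fiberι_residueFieldMap (x : π.fiber y) :
    Function.Bijective ((π.fiberι y).residueFieldMap x) := by
  refine ⟨((π.fiberι y).residueFieldMap x).hom.injective, fun z => ?_⟩
  obtain ⟨u, rfl⟩ := (π.fiber y).residue_surjective x z
  obtain ⟨v, rfl⟩ := (π.fiberι y).stalkMap_surjective x u
  exact ⟨X.residue _ v, congrArg (fun ψ => ψ.hom v)
    (Scheme.residue_residueFieldMap (π.fiberι y) x)⟩

theorem isRational_of_isRational_image (hπ : π ≫ strC = strX) (x : X)
    (hx : Function.Bijective (residueScalarHom strX x)) :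
    Function.Bijective (residueScalarHom strC (π x)) := by
  refine ⟨(residueScalarHom strC (π x)).injective, fun z => ?_⟩
  obtain ⟨c, hc⟩ := hx.2 (π.residueFieldMap x z)
  refine ⟨c, (π.residueFieldMap x).hom.injective ?_⟩
  rw [← hc, ← hπ]
  exact residueFieldMap_residueScalarHom π strC x c

theorem isRational_fiberι_iff (hπ : π ≫ strC = strX)
    (hy : Function.Bijective (residueScalarHom strC y)) (x : π.fiber y) :
    Function.Bijective (residueScalarHom strX (π.fiberι y x)) ↔
      Function.Bijective (residueScalarHom (fiberStr π y) x) := by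
  have h : ((π.fiberι y).residueFieldMap x) ∘ (residueScalarHom strX (π.fiberι y x)) =
      residueScalarHom (fiberStr π y) x ∘ residueScalarHom strC y :=
    funext fun c => residueScalarHom_fiberι π y hπ x c
  rw [← (bijective_fiberι_residueFieldMap π y x).of_comp_iff', h, hy.of_comp_iff]

/-- The rational points of `X` over a rational point `y` are those of the fibre. -/
def fiberRationalPoint (hπ : π ≫ strC = strX)
    (hy : Function.Bijective (residueScalarHom strC y)) :
    RationalPoint (fiberStr π y) ≃ {P : RationalPoint strX // π P.1 = y} :=
  Equiv.ofBijective
    (fun x => ⟨⟨π.fiberι y x.1, (isRational_fiberι_iff π y hπ hy x.1).mpr x.2⟩,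
      fiberι_apply π y x.1⟩) <| by
    constructor
    · intro x x' h
      apply Subtype.ext
      exact (π.fiberι y).isEmbedding.injective
        (congrArg (fun P : {P : RationalPoint strX // π P.1 = y} => P.1.1) h)
    · rintro ⟨⟨P, hP⟩, hPy⟩
      obtain ⟨z, rfl⟩ := exists_fiberι_eq π y hPy
      exact ⟨⟨z, (isRational_fiberι_iff π y hπ hy z).mp hP⟩, rfl⟩

theorem ker_fiberι_stalkMap (x : π.fiber y) :
    RingHom.ker ((π.fiberι y).stalkMap x).hom =
      (IsLocalRing.maximalIdeal (C.presheaf.stalk (π (π.fiberι y x)))).map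
        (π.stalkMap (π.fiberι y x)).hom := by
  refine le_antisymm (fun u hu => ?_)
    (Ideal.map_le_iff_le_comap.mpr fun a ha => fiberι_stalkMap_eq_zero π y x a ha)
  set I := (IsLocalRing.maximalIdeal (C.presheaf.stalk (π (π.fiberι y x)))).map
    (π.stalkMap (π.fiberι y x)).hom
  have hne : I ≠ ⊤ := ne_top_of_le_ne_top (IsLocalRing.maximalIdeal.isMaximal _).ne_top
    (IsLocalRing.map_maximalIdeal_le (π.stalkMap (π.fiberι y x)).hom)
  have : Nontrivial (X.presheaf.stalk (π.fiberι y x) ⧸ I) := Ideal.Quotient.nontrivial_iff.mpr hne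
  let A : CommRingCat.{u} := .of (X.presheaf.stalk (π.fiberι y x) ⧸ I)
  let m : X.presheaf.stalk (π.fiberι y x) ⟶ A := CommRingCat.ofHom (Ideal.Quotient.mk I)
  have : IsLocalRing A := IsLocalRing.of_surjective' m.hom Ideal.Quotient.mk_surjective
  have : IsLocalHom m.hom := IsLocalHom.of_surjective m.hom Ideal.Quotient.mk_surjective
  obtain ⟨b, hb⟩ := exists_comp_fromSpecResidueField π m
    (fun r hr => Ideal.Quotient.eq_zero_iff_mem.mpr (Ideal.mem_map_of_mem _ hr))
    (fiberι_apply π y x)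
  have hm : m u = 0 := eq_zero_of_stalkMap_eq_zero (π.fiberι y).isEmbedding.injective m
    (Limits.pullback.lift_fst _ _ hb) hu
  exact Ideal.Quotient.eq_zero_iff_mem.mp hm

end Fiber

/-! ### Local rings of integral schemes -/

theorem algebraMap_stalkSpecializes {X : Scheme.{u}} [IsIntegral X] {x y : X} (h : x ⤳ y)
    (u : X.presheaf.stalk y) :
    algebraMap (X.presheaf.stalk x) X.functionField (X.presheaf.stalkSpecializes h u) =
      algebraMap (X.presheaf.stalk y) X.functionField u :=
  X.presheaf.stalkSpecializes_comp_apply ((genericPoint_spec X).specializes trivial) h u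

theorem maximalIdeal_genericPoint {X : Scheme.{u}} [IsIntegral X] :
    IsLocalRing.maximalIdeal (X.presheaf.stalk (genericPoint X)) = ⊥ :=
  IsLocalRing.isField_iff_maximalIdeal_eq.mp (Field.toIsField X.functionField)

theorem eq_genericPoint_of_maximalIdeal_eq_bot {X : Scheme.{u}} [IsIntegral X] {x : X}
    (hx : IsLocalRing.maximalIdeal (X.presheaf.stalk x) = ⊥) : x = genericPoint X := by
  have hg : genericPoint X ∈ Set.range (X.fromSpecStalk x) := by
    rw [Scheme.range_fromSpecStalk]
    exact (genericPoint_spec X).specializes trivial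
  obtain ⟨G, hG⟩ := hg
  have hclosed : IsLocalRing.closedPoint (X.presheaf.stalk x) = G := PrimeSpectrum.ext <|
    le_antisymm (hx.trans_le bot_le) (IsLocalRing.le_maximalIdeal G.2.ne_top)
  rw [← hG, ← hclosed]
  exact Scheme.fromSpecStalk_closedPoint.symm

theorem exists_isClosed_specializes (X : Scheme.{u}) [CompactSpace X] (y : X) :
    ∃ p : X, IsClosed ({p} : Set X) ∧ y ⤳ p := by
  obtain ⟨p, hp, hp'⟩ := IsClosed.exists_closed_singleton (isClosed_closure (s := {y}))
    ⟨y, subset_closure rfl⟩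
  exact ⟨p, hp', specializes_iff_mem_closure.mpr hp⟩

theorem eq_or_eq_genericPoint_of_specializes {X : Scheme.{u}} [IsIntegral X] {p y : X}
    [IsNoetherianRing (X.presheaf.stalk p)] (h : y ⤳ p)
    (hp : (IsLocalRing.maximalIdeal (X.presheaf.stalk p)).IsPrincipal) :
    y = p ∨ y = genericPoint X := by
  have hgen : ∀ x : X, genericPoint X ⤳ x := fun _ => (genericPoint_spec X).specializes trivial
  have hrange : ∀ x : X, x ⤳ p → x ∈ Set.range (X.fromSpecStalk p) := fun x hx => by
    rwa [Scheme.range_fromSpecStalk]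
  have : IsPrincipalIdealRing (X.presheaf.stalk p) :=
    ((tfae_of_isNoetherianRing_of_isLocalRing_of_isDomain (X.presheaf.stalk p)).out 0 4).mpr hp
  obtain ⟨Q, rfl⟩ := hrange y h
  obtain ⟨G, hG⟩ := hrange _ (hgen p)
  by_cases hQ : Q.asIdeal = ⊥
  · have hQG : Q ⤳ G := (PrimeSpectrum.le_iff_specializes Q G).mp (hQ.trans_le bot_le)
    exact Or.inr ((hG ▸ hQG.map (X.fromSpecStalk p).continuous).antisymm (hgen _)).eq
  · have := Q.2
    have hmax : Q = IsLocalRing.closedPoint (X.presheaf.stalk p) :=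
      PrimeSpectrum.ext (IsLocalRing.eq_maximalIdeal (IsPrime.to_maximal_ideal hQ))
    exact Or.inl (hmax ▸ Scheme.fromSpecStalk_closedPoint)

theorem not_isStandardSmoothOfRelativeDimension_one {A B : Type*} [Field A] [PerfectField A]
    [Field B] (φ : A →+* B) : ¬ φ.IsStandardSmoothOfRelativeDimension 1 := by
  intro h
  let _ := φ.toAlgebra
  have h' : Algebra.IsStandardSmoothOfRelativeDimension 1 A B := h
  have := h'.isStandardSmooth
  have : Module.Finite A B := finite_of_finite_type_of_isJacobsonRing A B
  have : Algebra.FormallyUnramified A B := Algebra.FormallyUnramified.of_isSeparable A B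
  have hrank := Algebra.IsStandardSmoothOfRelativeDimension.rank_kaehlerDifferential (R := A)
    (S := B) 1
  rw [rank_subsingleton'] at hrank
  exact zero_ne_one (hrank.trans Nat.cast_one)

theorem not_isClosed_genericPoint {k : Type u} [Field k] [PerfectField k] {C : Scheme.{u}}
    [IsIntegral C] (s : C ⟶ Spec (.of k)) [hs : SmoothOfRelativeDimension 1 s] :
    ¬ IsClosed ({genericPoint C} : Set C) := by
  intro h
  have hsub : Subsingleton C := by
    have huniv : {genericPoint C} = (Set.univ : Set C) :=
      h.closure_eq.symm.trans (genericPoint_spec C).def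
    exact Set.subsingleton_univ_iff.mp (huniv ▸ Set.subsingleton_singleton)
  have hk : Subsingleton (Spec (.of k) : Scheme.{u}) :=
    inferInstanceAs (Subsingleton (PrimeSpectrum k))
  obtain ⟨U, -, V, -, hV, hUV, hsm⟩ :=
    hs.exists_isStandardSmoothOfRelativeDimension (genericPoint C)
  obtain rfl : V = ⊤ := top_le_iff.mp fun y _ => Subsingleton.elim (genericPoint C) y ▸ hV
  obtain rfl : U = ⊤ := top_le_iff.mp fun y _ => Subsingleton.elim (s (genericPoint C)) y ▸ hUV hV
  let ε : k ≃+* Γ(Spec (.of k), ⊤) := (Scheme.ΓSpecIso (.of k)).commRingCatIsoToRingEquiv.symm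
  let _ := (ε.symm.toMulEquiv.isField (Field.toIsField k)).toField
  let _ := (isField_of_isIntegral_of_subsingleton C).toField
  have := PerfectField.of_ringEquiv ε
  exact not_isStandardSmoothOfRelativeDimension_one _ hsm

/-! ### The base curve -/

namespace RuledSurface

variable {k : Type u} [Field k] (R : RuledSurface k)

instance : LocallyOfFiniteType R.strX := R.properX.toLocallyOfFiniteType

instance : LocallyOfFiniteType R.strC := R.properC.toLocallyOfFiniteType

instance : QuasiCompact R.strC :=
  have := R.properC
  inferInstance

instance : IsLocallyNoetherian R.X := LocallyOfFiniteType.isLocallyNoetherian R.strX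

instance : IsLocallyNoetherian R.C := LocallyOfFiniteType.isLocallyNoetherian R.strC

instance : CompactSpace R.C := QuasiCompact.compactSpace_of_compactSpace R.strC

theorem π_σ (y : R.C) : R.π (R.σ y) = y := by
  rw [← Scheme.Hom.comp_apply, R.σ_π]
  rfl

theorem π_genericPoint : R.π (genericPoint R.X) = genericPoint R.C := by
  have hsurj : R.π '' Set.univ = Set.univ :=
    Set.image_univ_of_surjective fun y => ⟨R.σ y, R.π_σ y⟩
  have h : IsGenericPoint (R.π (genericPoint R.X)) (closure (R.π '' Set.univ)) :=
    (genericPoint_spec R.X).image R.π.continuous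
  rw [hsurj, closure_univ] at h
  exact h.eq (genericPoint_spec R.C)

/-- The inclusion `π^* : K(C) → K(X)` of function fields. -/
def pb : R.C.functionField →+* R.X.functionField :=
  (R.π.stalkMap (genericPoint R.X)).hom.comp
    (R.C.presheaf.stalkSpecializes (specializes_of_eq R.π_genericPoint)).hom

theorem pb_algebraMap (x : R.X) (a : R.C.presheaf.stalk (R.π x)) :
    R.pb (algebraMap _ R.C.functionField a) =
      algebraMap _ R.X.functionField (R.π.stalkMap x a) := by
  have hx : genericPoint R.X ⤳ x := (genericPoint_spec R.X).specializes trivial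
  have hcomp : R.pb (algebraMap _ R.C.functionField a) = R.π.stalkMap (genericPoint R.X)
      (R.C.presheaf.stalkSpecializes (hx.map R.π.continuous) a) :=
    congrArg (R.π.stalkMap (genericPoint R.X)).hom (R.C.presheaf.stalkSpecializes_comp_apply _ _ a)
  exact hcomp.trans (congrArg (fun ψ => ψ.hom a) (R.π.stalkSpecializes_stalkMap _ _ hx))

/-- The maximal ideals of the local rings of `C` at closed points are principal. This holds because
`C` is regular; here it is read off a divisor `𝔡` on `C` representing `C₀²`, whose local equations
involve such generators. -/
def HasUniformizers : Prop :=
  ∀ p : R.C, IsClosed ({p} : Set R.C) →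
    (IsLocalRing.maximalIdeal (R.C.presheaf.stalk p)).IsPrincipal

variable {R}

theorem SelfIntersection.hasUniformizers {m : ℤ} (h : R.SelfIntersection m) :
    R.HasUniformizers := by
  obtain ⟨_, _, -, hloc⟩ := h
  intro p hp
  obtain ⟨_, _, _, -, -, -, -, _, ϖ, hϖ, -⟩ := hloc p hp
  exact ⟨ϖ, hϖ.symm⟩

theorem HasUniformizers.eq_genericPoint (hU : R.HasUniformizers) {y : R.C}
    (hy : ¬ IsClosed ({y} : Set R.C)) : y = genericPoint R.C := by
  obtain ⟨p, hp, hyp⟩ := exists_isClosed_specializes R.C y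
  rcases eq_or_eq_genericPoint_of_specializes hyp (hU p hp) with rfl | h
  · exact absurd hp hy
  · exact h

theorem HasUniformizers.exists_span_eq (hU : R.HasUniformizers) (y : R.C) :
    ∃ ϖ : R.C.presheaf.stalk y,
      Ideal.span {ϖ} = IsLocalRing.maximalIdeal (R.C.presheaf.stalk y) := by
  by_cases hy : IsClosed ({y} : Set R.C)
  · obtain ⟨ϖ, h⟩ := hU y hy
    exact ⟨ϖ, h.symm⟩
  · obtain rfl := hU.eq_genericPoint hy
    exact ⟨0, by rw [maximalIdeal_genericPoint, Ideal.span_singleton_eq_bot]⟩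

theorem uniformizer_ne_zero [PerfectField k] {p : R.C} (hp : IsClosed ({p} : Set R.C))
    {ϖ : R.C.presheaf.stalk p}
    (hϖ : Ideal.span {ϖ} = IsLocalRing.maximalIdeal (R.C.presheaf.stalk p)) : ϖ ≠ 0 := by
  rintro rfl
  have := R.smoothC
  rw [Ideal.span_singleton_zero] at hϖ
  rw [eq_genericPoint_of_maximalIdeal_eq_bot hϖ.symm] at hp
  exact not_isClosed_genericPoint R.strC hp

end RuledSurface

/-! ### The ideal of the section -/

theorem map_stalkSpecializes_ker_stalkMap {X Y : Scheme.{u}} [IsIntegral Y] (ι : Y ⟶ X) {y p : Y}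
    (h : y ⤳ p) :
    (RingHom.ker (ι.stalkMap p).hom).map
        (X.presheaf.stalkSpecializes (h.map ι.continuous)).hom =
      RingHom.ker (ι.stalkMap y).hom := by
  have hspec : ι y ⤳ ι p := h.map ι.continuous
  have hcomm (u : X.presheaf.stalk (ι p)) : ι.stalkMap y (X.presheaf.stalkSpecializes hspec u) =
      Y.presheaf.stalkSpecializes h (ι.stalkMap p u) :=
    congrArg (fun ψ => ψ.hom u) (ι.stalkSpecializes_stalkMap _ _ h)
  refine le_antisymm (Ideal.map_le_iff_le_comap.mpr fun u hu => ?_) fun u hu => ?_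
  · exact (hcomm u).trans ((congrArg _ hu).trans (map_zero _))
  obtain ⟨U, hU, hpU, -⟩ :=
    exists_isAffineOpen_mem_and_subset (X := X) (x := ι p) (U := ⊤) trivial
  have hyU : ι y ∈ U := hspec.mem_open U.2 hpU
  obtain ⟨a, b, hb, hab⟩ := exists_germ_mul_eq hU hyU u
  have hgerm : X.presheaf.stalkSpecializes hspec (X.presheaf.germ U (ι p) hpU a) =
      X.presheaf.germ U (ι y) hyU a := X.presheaf.germ_stalkSpecializes_apply hpU hspec a
  have ha : X.presheaf.germ U (ι p) hpU a ∈ RingHom.ker (ι.stalkMap p).hom := by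
    have hzero : ι.stalkMap y (X.presheaf.germ U (ι y) hyU a) = 0 :=
      Ideal.mul_mem_right _ (RingHom.ker (ι.stalkMap y).hom) hu |> (hab ▸ ·)
    rw [← hgerm, hcomm] at hzero
    apply IsFractionRing.injective (Y.presheaf.stalk p) Y.functionField
    rw [map_zero, ← algebraMap_stalkSpecializes h]
    exact (congrArg _ hzero).trans (map_zero _)
  refine (Ideal.mul_unit_mem_iff_mem _ hb).mp ?_
  rw [hab, ← hgerm]
  exact Ideal.mem_map_of_mem _ ha

theorem span_singleton_eq_of_le_sup {A : Type*} [CommRing A] [IsLocalRing A] {I : Ideal A}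
    [I.IsPrime] (hI : I.FG) {g t : A} (hg : g ∈ I) (ht : t ∈ IsLocalRing.maximalIdeal A)
    (htI : t ∉ I) (hle : I ≤ Ideal.span {g} ⊔ Ideal.span {t}) : Ideal.span {g} = I := by
  have hgI : Ideal.span {g} ≤ I := (Ideal.span_singleton_le_iff_mem _).mpr hg
  refine le_antisymm hgI (Submodule.le_of_le_smul_of_le_jacobson_bot hI
    (IsLocalRing.maximalIdeal_le_jacobson _) fun w hw => ?_)
  obtain ⟨a, ha, b, hb, rfl⟩ := Submodule.mem_sup.mp (hle hw)
  obtain ⟨d, rfl⟩ := Ideal.mem_span_singleton.mp hb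
  have htd : t * d ∈ I := (Submodule.add_mem_iff_right I (hgI ha)).mp hw
  exact Submodule.add_mem_sup ha
    (Submodule.smul_mem_smul ht ((Ideal.IsPrime.mem_or_mem ‹_› htd).resolve_left htI))

namespace RuledSurface

variable {k : Type u} [Field k] (R : RuledSurface k)

theorem isClosed_range_σ : IsClosed (Set.range R.σ) := by
  have hσ : R.σ ≫ R.strX = R.strC := by
    rw [← R.π_over, ← Category.assoc, R.σ_π, Category.id_comp]
  have := R.properX
  have : IsProper (R.σ ≫ R.strX) := hσ ▸ R.properC
  have : IsProper R.σ := IsProper.of_comp R.σ R.strX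
  exact R.σ.isClosedMap.isClosed_range

theorem idealC₀_eq_top {x : R.X} (hx : x ∉ Set.range R.σ) : R.idealC₀ x = ⊤ := by
  rw [Ideal.eq_top_iff_one]
  let U : R.X.Opens := ⟨(Set.range R.σ)ᶜ, R.isClosed_range_σ.isOpen_compl⟩
  have hU : R.σ ⁻¹ᵁ U = ⊥ := by
    ext y
    simp [U]
  have : Subsingleton Γ(R.C, R.σ ⁻¹ᵁ U) := hU ▸ inferInstance
  exact Ideal.subset_span ⟨U, hx, 1, Subsingleton.elim _ _, map_one _⟩

theorem idealC₀_σ (y : R.C) : R.idealC₀ (R.σ y) = RingHom.ker (R.σ.stalkMap y).hom := by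
  refine le_antisymm (Ideal.span_le.mpr ?_) fun u hu => ?_
  · rintro _ ⟨U, hx, a, ha, rfl⟩
    change R.σ.stalkMap y _ = 0
    rw [Scheme.Hom.germ_stalkMap_apply, ha, map_zero]
  · obtain ⟨U, hU, a, rfl⟩ := R.X.presheaf.exists_germ_eq u
    have ha : R.C.presheaf.germ _ y hU (R.σ.app U a) = 0 :=
      (Scheme.Hom.germ_stalkMap_apply ..).symm.trans hu
    have : Nonempty (R.σ ⁻¹ᵁ U) := ⟨⟨y, hU⟩⟩
    exact Ideal.subset_span
      ⟨U, hU, a, (map_eq_zero_iff _ (germ_injective_of_isIntegral R.C y hU)).mp ha, rfl⟩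

theorem bijective_σ_π (y : R.C) :
    Function.Bijective fun a => R.σ.stalkMap y (R.π.stalkMap (R.σ y) a) := by
  have hiso : IsIso (R.σ ≫ R.π) := by
    rw [R.σ_π]
    infer_instance
  have hbij := ConcreteCategory.bijective_of_isIso ((R.σ ≫ R.π).stalkMap y)
  rwa [Scheme.Hom.stalkMap_comp] at hbij

variable {R}

theorem exists_sub_mem_idealC₀ {x : R.X} (hx : x ∈ Set.range R.σ) (u : R.X.presheaf.stalk x) :
    ∃ a, u - R.π.stalkMap x a ∈ R.idealC₀ x := by
  obtain ⟨y, rfl⟩ := hx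
  obtain ⟨a, ha⟩ := (R.bijective_σ_π y).2 (R.σ.stalkMap y u)
  rw [idealC₀_σ]
  exact ⟨a, (map_sub (R.σ.stalkMap y).hom _ _).trans (sub_eq_zero.mpr ha.symm)⟩

theorem eq_zero_of_stalkMap_mem_idealC₀ {x : R.X} (hx : x ∈ Set.range R.σ)
    {a : R.C.presheaf.stalk (R.π x)} (ha : R.π.stalkMap x a ∈ R.idealC₀ x) : a = 0 := by
  obtain ⟨y, rfl⟩ := hx
  rw [idealC₀_σ] at ha
  exact (R.bijective_σ_π y).1 ((show R.σ.stalkMap y _ = 0 from ha).trans (by simp))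

theorem isPrime_idealC₀ {x : R.X} (hx : x ∈ Set.range R.σ) : (R.idealC₀ x).IsPrime := by
  obtain ⟨y, rfl⟩ := hx
  rw [idealC₀_σ]
  exact RingHom.ker_isPrime _

theorem exists_mem_idealC₀_fiberι_stalkMap_eq {y : R.C} {z : R.π.fiber y}
    (hz : R.π.fiberι y z ∈ Set.range R.σ) {γ : (R.π.fiber y).presheaf.stalk z}
    (hγ : γ ∈ IsLocalRing.maximalIdeal _) :
    ∃ g ∈ R.idealC₀ (R.π.fiberι y z), (R.π.fiberι y).stalkMap z g = γ := by
  have hle : R.idealC₀ (R.π.fiberι y z) ≤ IsLocalRing.maximalIdeal _ :=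
    IsLocalRing.le_maximalIdeal (isPrime_idealC₀ hz).ne_top
  obtain ⟨v, rfl⟩ := (R.π.fiberι y).stalkMap_surjective z γ
  have hv : v ∈ IsLocalRing.maximalIdeal _ :=
    (map_mem_nonunits_iff ((R.π.fiberι y).stalkMap z).hom v).mp hγ
  obtain ⟨a, ha⟩ := exists_sub_mem_idealC₀ hz v
  have hπa : R.π.stalkMap (R.π.fiberι y z) a ∈ IsLocalRing.maximalIdeal _ :=
    (Submodule.sub_mem_iff_right _ hv).mp (hle ha)
  have ham : a ∈ IsLocalRing.maximalIdeal _ :=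
    (map_mem_nonunits_iff (R.π.stalkMap (R.π.fiberι y z)).hom a).mp hπa
  have ha0 : (R.π.fiberι y).stalkMap z (R.π.stalkMap (R.π.fiberι y z) a) = 0 := by
    have hker := Ideal.mem_map_of_mem (R.π.stalkMap (R.π.fiberι y z)).hom ham
    rwa [← ker_fiberι_stalkMap] at hker
  exact ⟨_, ha, (map_sub _ _ _).trans (by rw [ha0, sub_zero])⟩

theorem span_eq_idealC₀_of_fiberι_stalkMap {y : R.C} {z : R.π.fiber y}
    (hz : R.π.fiberι y z ∈ Set.range R.σ) {ϖ : R.C.presheaf.stalk (R.π (R.π.fiberι y z))}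
    (hϖ : Ideal.span {ϖ} = IsLocalRing.maximalIdeal _) (hϖ0 : ϖ ≠ 0)
    {g : R.X.presheaf.stalk (R.π.fiberι y z)} (hg : g ∈ R.idealC₀ (R.π.fiberι y z))
    (hgz : Ideal.span {(R.π.fiberι y).stalkMap z g} = IsLocalRing.maximalIdeal _) :
    Ideal.span {g} = R.idealC₀ (R.π.fiberι y z) := by
  have := isPrime_idealC₀ hz
  have hker : RingHom.ker ((R.π.fiberι y).stalkMap z).hom =
      Ideal.span {R.π.stalkMap (R.π.fiberι y z) ϖ} := by
    rw [ker_fiberι_stalkMap, ← hϖ, Ideal.map_span, Set.image_singleton]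
  have hmax : ϖ ∈ IsLocalRing.maximalIdeal _ := hϖ ▸ Ideal.mem_span_singleton_self ϖ
  refine span_singleton_eq_of_le_sup (IsNoetherian.noetherian _) hg
    ((map_mem_nonunits_iff (R.π.stalkMap (R.π.fiberι y z)).hom ϖ).mpr hmax)
    (fun h => hϖ0 (eq_zero_of_stalkMap_mem_idealC₀ hz h)) fun w hw => ?_
  have hwm := (map_mem_nonunits_iff ((R.π.fiberι y).stalkMap z).hom w).mpr
    (IsLocalRing.le_maximalIdeal (isPrime_idealC₀ hz).ne_top hw)
  obtain ⟨c', hc'⟩ := Ideal.mem_span_singleton'.mp (hgz.ge hwm)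
  obtain ⟨c, rfl⟩ := (R.π.fiberι y).stalkMap_surjective z c'
  rw [← hker, ← sub_add_cancel w (c * g), add_comm]
  refine Submodule.add_mem_sup (Ideal.mul_mem_left _ _ (Ideal.mem_span_singleton_self g)) ?_
  exact (map_sub _ _ _).trans (sub_eq_zero.mpr (hc'.symm.trans (map_mul _ _ _).symm))

variable (R) in
/-- The section `Spec κ(y) → X_y` of the fibre over `y` induced by `σ`. -/
def fiberSection (y : R.C) : Spec (.of (R.C.residueField y)) ⟶ R.π.fiber y :=
  Limits.pullback.lift (R.C.fromSpecResidueField y ≫ R.σ) (𝟙 _) (by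
    rw [Category.assoc, R.σ_π, Category.comp_id]
    exact (Category.id_comp _).symm)

variable (R) in
/-- The point `σ y` of the fibre over `y`, as a rational point of that fibre. -/
def fiberPoint (y : R.C) : RationalPoint (fiberStr R.π y) :=
  ⟨R.fiberSection y (IsLocalRing.closedPoint (R.C.residueField y)),
    isRational_of_section (fiberStr R.π y) (R.fiberSection y) (Limits.pullback.lift_snd _ _ _) _⟩

theorem fiberι_fiberPoint (y : R.C) : R.π.fiberι y (R.fiberPoint y).1 = R.σ y := by
  have h : R.fiberSection y ≫ R.π.fiberι y = R.C.fromSpecResidueField y ≫ R.σ :=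
    Limits.pullback.lift_fst _ _ _
  refine (Scheme.Hom.comp_apply _ _ _).symm.trans ?_
  refine (congrArg (fun f : Spec (.of (R.C.residueField y)) ⟶ R.X =>
    f (IsLocalRing.closedPoint (R.C.residueField y))) h).trans ?_
  exact (Scheme.Hom.comp_apply _ _ _).trans
    (congrArg R.σ (Scheme.fromSpecResidueField_apply y _))

theorem exists_fiber_equation [PerfectField k] (hU : R.HasUniformizers) {y : R.C}
    (hy : IsClosed ({y} : Set R.C)) :
    ∃ g, Ideal.span {g} = R.idealC₀ (R.π.fiberι y (R.fiberPoint y).1) ∧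
      (R.π.fiberι y).stalkMap (R.fiberPoint y).1 g ≠ 0 ∧
      Ideal.span {(R.π.fiberι y).stalkMap (R.fiberPoint y).1 g} = IsLocalRing.maximalIdeal _ := by
  obtain ⟨D⟩ := nonempty_projLineCharts (R.fiber_projLine y hy)
  have := D.isIntegral
  obtain ⟨γ, hγ0, hγ⟩ := D.exists_span_eq_maximalIdeal (R.fiberPoint y)
  obtain ⟨ϖ, hϖ⟩ := hU.exists_span_eq (R.π (R.π.fiberι y (R.fiberPoint y).1))
  have hϖ0 : ϖ ≠ 0 := uniformizer_ne_zero ((fiberι_apply R.π y _).symm ▸ hy) hϖ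
  have hz : R.π.fiberι y (R.fiberPoint y).1 ∈ Set.range R.σ := ⟨y, (fiberι_fiberPoint y).symm⟩
  obtain ⟨g, hg, rfl⟩ :=
    exists_mem_idealC₀_fiberι_stalkMap_eq hz (hγ ▸ Ideal.mem_span_singleton_self γ)
  exact ⟨g, span_eq_idealC₀_of_fiberι_stalkMap hz hϖ hϖ0 hg hγ, hγ0, hγ⟩

theorem exists_span_eq_idealC₀ [PerfectField k] (hU : R.HasUniformizers) (x : R.X) :
    ∃ g, g ≠ 0 ∧ Ideal.span {g} = R.idealC₀ x := by
  by_cases hx : x ∈ Set.range R.σ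
  · obtain ⟨y, rfl⟩ := hx
    obtain ⟨p, hp, hyp⟩ := exists_isClosed_specializes R.C y
    have hspec := hyp.map R.σ.continuous
    obtain ⟨g, hg0, hg⟩ : ∃ g : R.X.presheaf.stalk (R.σ p), g ≠ 0 ∧
        Ideal.span {g} = R.idealC₀ (R.σ p) := by
      obtain ⟨g, hg, hg0, -⟩ := exists_fiber_equation hU hp
      rw [← fiberι_fiberPoint p]
      exact ⟨g, fun h => hg0 (h ▸ map_zero _), hg⟩
    refine ⟨R.X.presheaf.stalkSpecializes hspec g, fun h0 => hg0 ?_, ?_⟩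
    · apply IsFractionRing.injective (R.X.presheaf.stalk (R.σ p)) R.X.functionField
      rw [← algebraMap_stalkSpecializes hspec, h0, map_zero, map_zero]
    · rw [idealC₀_σ, ← map_stalkSpecializes_ker_stalkMap R.σ hyp, ← idealC₀_σ, ← hg,
        Ideal.map_span, Set.image_singleton]
  · exact ⟨1, one_ne_zero, by rw [idealC₀_eq_top R hx, Ideal.span_singleton_one]⟩

end RuledSurface

/-! ### Local equations -/

section GeneratesIdeal

variable {A K : Type*} [CommRing A] [Field K] [Algebra A K]

/-- The element `t` of the fraction field `K` of `A` is a generator of the ideal `I` of `A`. Stating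
this in `K` lets generators be compared between local rings of the same integral scheme. -/
def GeneratesIdeal (I : Ideal A) (t : K) : Prop :=
  ∃ g : A, Ideal.span {g} = I ∧ algebraMap A K g = t

theorem GeneratesIdeal.exists_unit_mul_eq [IsDomain A] {I : Ideal A} {t t' : K}
    (h : GeneratesIdeal I t) (h' : GeneratesIdeal I t') : ∃ w : Aˣ, algebraMap A K w * t = t' := by
  obtain ⟨g, hg, rfl⟩ := h
  obtain ⟨g', hg', rfl⟩ := h'
  obtain ⟨w, rfl⟩ := Ideal.span_singleton_eq_span_singleton.mp (hg.trans hg'.symm)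
  exact ⟨w, by rw [map_mul, mul_comm]⟩

theorem exists_lower_bound_of_mul_zpow_mem_range [IsFractionRing A K] [IsNoetherianRing A]
    [IsLocalRing A] {p : A} (hp : p ∈ IsLocalRing.maximalIdeal A) (hp0 : p ≠ 0)
    {φ : K} (hφ : φ ≠ 0) :
    ∃ m : ℤ, ∀ n : ℤ, φ * algebraMap A K p ^ n ∈ (algebraMap A K).range → m ≤ n := by
  obtain ⟨a, c, -, rfl⟩ := IsFractionRing.div_surjective A φ
  have ha0 : a ≠ 0 := by
    rintro rfl
    simp at hφ
  have hc0 : algebraMap A K c ≠ 0 := by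
    intro hc
    simp [hc] at hφ
  have hpK : algebraMap A K p ≠ 0 := (map_ne_zero_iff _ (IsFractionRing.injective A K)).mpr hp0
  obtain ⟨j, hj⟩ : ∃ j : ℕ, a ∉ IsLocalRing.maximalIdeal A ^ j := by
    by_contra! h
    have hkrull := Ideal.iInf_pow_eq_bot_of_isLocalRing (IsLocalRing.maximalIdeal A)
      (IsLocalRing.maximalIdeal.isMaximal A).ne_top
    exact ha0 ((Submodule.mem_bot A).mp (hkrull ▸ (Submodule.mem_iInf _).mpr h))
  refine ⟨-j, fun n ⟨v, hv⟩ => ?_⟩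
  by_contra! hlt
  obtain ⟨i, rfl⟩ : ∃ i : ℕ, n = -i := ⟨(-n).toNat, by omega⟩
  have hav : a = v * c * p ^ i := by
    apply IsFractionRing.injective A K
    rw [map_mul, map_mul, map_pow, hv, zpow_neg, zpow_natCast]
    field_simp
  exact hj (hav ▸ Ideal.mul_mem_left _ _
    (Ideal.pow_le_pow_right (by omega) (Ideal.pow_mem_pow hp i)))

end GeneratesIdeal

namespace RuledSurface

variable {k : Type u} [Field k] (R : RuledSurface k)

/-- `t` is a local equation at `x` of `b C₀ + n π^*(π x)`. Unlike in `IsLocalEquation`, the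
multiplicity `n` of the fibre is a parameter, and the equations of `C₀` and of `π x` are taken in
the function fields. -/
def IsEquationAt (b n : ℤ) (x : R.X) (t : R.X.functionField) : Prop :=
  ∃ (w : (R.X.presheaf.stalk x)ˣ) (γ : R.X.functionField) (s : R.C.functionField),
    GeneratesIdeal (R.idealC₀ x) γ ∧
    GeneratesIdeal (IsLocalRing.maximalIdeal (R.C.presheaf.stalk (R.π x))) s ∧
    t = algebraMap (R.X.presheaf.stalk x) R.X.functionField w * γ ^ b * R.pb s ^ n

/-- `f` is a section of `𝒪_X(b C₀ + n π^*(π x))` near `x`. -/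
def IsRegularAt (b n : ℤ) (x : R.X) (f : R.X.functionField) : Prop :=
  ∀ t, R.IsEquationAt b n x t →
    f * t ∈ (algebraMap (R.X.presheaf.stalk x) R.X.functionField).range

/-- `f` is a section of `𝒪_X(b C₀ + n π^*y)` near the fibre over `y`. -/
def IsRegularOnFiber (b n : ℤ) (y : R.C) (f : R.X.functionField) : Prop :=
  ∀ x, R.π x = y → R.IsRegularAt b n x f

/-- `f` generates `𝒪_X(b C₀ + n π^*(π x))` near `x`. -/
def IsUnitAt (b n : ℤ) (x : R.X) (f : R.X.functionField) : Prop :=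
  ∃ (t : R.X.functionField) (w : (R.X.presheaf.stalk x)ˣ), R.IsEquationAt b n x t ∧
    algebraMap (R.X.presheaf.stalk x) R.X.functionField w = f * t

variable {R}

theorem IsEquationAt.exists_unit_mul_eq {b n : ℤ} {x : R.X} {t t' : R.X.functionField}
    (h : R.IsEquationAt b n x t) (h' : R.IsEquationAt b n x t') :
    ∃ v : (R.X.presheaf.stalk x)ˣ,
      algebraMap (R.X.presheaf.stalk x) R.X.functionField v * t = t' := by
  obtain ⟨w, γ, s, hγ, hs, rfl⟩ := h
  obtain ⟨w', γ', s', hγ', hs', rfl⟩ := h'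
  obtain ⟨v, rfl⟩ := hγ.exists_unit_mul_eq hγ'
  obtain ⟨c, rfl⟩ := hs.exists_unit_mul_eq hs'
  let c' : (R.X.presheaf.stalk x)ˣ := Units.map (R.π.stalkMap x).hom c
  have hc : R.pb (algebraMap (R.C.presheaf.stalk (R.π x)) R.C.functionField c) =
      algebraMap (R.X.presheaf.stalk x) R.X.functionField c' := R.pb_algebraMap x c
  refine ⟨w⁻¹ * w' * v ^ b * c' ^ n, ?_⟩
  have hw : algebraMap (R.X.presheaf.stalk x) R.X.functionField ↑w⁻¹ *
      algebraMap (R.X.presheaf.stalk x) R.X.functionField w = 1 := by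
    rw [← map_mul, Units.inv_mul, map_one]
  simp only [Units.val_mul, map_mul, mul_zpow, map_units_zpow, hc]
  linear_combination (algebraMap (R.X.presheaf.stalk x) R.X.functionField w' *
    algebraMap (R.X.presheaf.stalk x) R.X.functionField v ^ b *
    algebraMap (R.X.presheaf.stalk x) R.X.functionField c' ^ n * γ ^ b * R.pb s ^ n) * hw

theorem isRegularAt_iff {b n : ℤ} {x : R.X} {f t : R.X.functionField}
    (ht : R.IsEquationAt b n x t) : R.IsRegularAt b n x f ↔
      f * t ∈ (algebraMap (R.X.presheaf.stalk x) R.X.functionField).range := by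
  refine ⟨fun h => h t ht, fun h t' ht' => ?_⟩
  obtain ⟨v, rfl⟩ := ht.exists_unit_mul_eq ht'
  rw [mul_left_comm]
  exact mul_mem ⟨_, rfl⟩ h

theorem IsUnitAt.isUnit {b n : ℤ} {x : R.X} {f t : R.X.functionField} (h : R.IsUnitAt b n x f)
    (ht : R.IsEquationAt b n x t) {u : R.X.presheaf.stalk x}
    (hu : algebraMap (R.X.presheaf.stalk x) R.X.functionField u = f * t) : IsUnit u := by
  obtain ⟨t', w, ht', hw⟩ := h
  obtain ⟨v, rfl⟩ := ht'.exists_unit_mul_eq ht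
  have huv : u = (v * w : (R.X.presheaf.stalk x)ˣ) := by
    apply IsFractionRing.injective (R.X.presheaf.stalk x) R.X.functionField
    rw [hu, Units.val_mul, map_mul, hw, mul_left_comm]
  exact huv ▸ Units.isUnit _

theorem isLocalEquation_iff {b : ℤ} {𝔟 : CurveDivisor R.C} {x : R.X} {t : R.X.functionField} :
    R.IsLocalEquation b 𝔟 x t ↔ R.IsEquationAt b (coeff 𝔟 (R.π x)) x t := by
  constructor
  · rintro ⟨w, g, ϖ, hg, hϖ, rfl⟩
    exact ⟨w, _, _, ⟨g, hg, rfl⟩, ⟨ϖ, hϖ, rfl⟩, by rw [R.pb_algebraMap]⟩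
  · rintro ⟨w, _, _, ⟨g, hg, rfl⟩, ⟨ϖ, hϖ, rfl⟩, rfl⟩
    exact ⟨w, g, ϖ, hg, hϖ, by rw [R.pb_algebraMap]⟩

theorem mem_sections_iff {b : ℤ} {𝔟 : CurveDivisor R.C} {f : R.X.functionField} :
    f ∈ R.sections b 𝔟 ↔ ∀ x, R.IsRegularAt b (coeff 𝔟 (R.π x)) x f :=
  forall_congr' fun _ => forall_congr' fun _ => imp_congr_left isLocalEquation_iff

theorem isRegularOnFiber_of_mem_sections {b : ℤ} {𝔟 : CurveDivisor R.C} {f : R.X.functionField}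
    (hf : f ∈ R.sections b 𝔟) (y : R.C) : R.IsRegularOnFiber b (coeff 𝔟 y) y f := by
  rintro x rfl
  exact mem_sections_iff.mp hf x

theorem HasUniformizers.exists_generatesIdeal (hU : R.HasUniformizers) (y : R.C) :
    ∃ s : R.C.functionField,
      GeneratesIdeal (IsLocalRing.maximalIdeal (R.C.presheaf.stalk y)) s := by
  obtain ⟨ϖ, hϖ⟩ := hU.exists_span_eq y
  exact ⟨_, ϖ, hϖ, rfl⟩

theorem pb_uniformizer_ne_zero [PerfectField k] {y : R.C} (hy : IsClosed ({y} : Set R.C))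
    {s : R.C.functionField}
    (hs : GeneratesIdeal (IsLocalRing.maximalIdeal (R.C.presheaf.stalk y)) s) : R.pb s ≠ 0 := by
  obtain ⟨ϖ, hϖ, rfl⟩ := hs
  exact (map_ne_zero _).mpr ((map_ne_zero_iff _ (IsFractionRing.injective _ _)).mpr
    (uniformizer_ne_zero hy hϖ))

theorem exists_isLocalEquation [PerfectField k] (hU : R.HasUniformizers) (b : ℤ)
    (𝔟 : CurveDivisor R.C) (x : R.X) : ∃ t, R.IsLocalEquation b 𝔟 x t := by
  obtain ⟨g, -, hg⟩ := exists_span_eq_idealC₀ hU x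
  obtain ⟨ϖ, hϖ⟩ := hU.exists_span_eq (R.π x)
  exact ⟨_, 1, g, ϖ, hg, hϖ, rfl⟩

theorem exists_lower_bound_isRegularAt [PerfectField k] (hU : R.HasUniformizers) {x : R.X}
    (hx : IsClosed ({R.π x} : Set R.C)) (b : ℤ) {f : R.X.functionField} (hf0 : f ≠ 0) :
    ∃ m : ℤ, ∀ n, R.IsRegularAt b n x f → m ≤ n := by
  obtain ⟨g, hg0, hg⟩ := exists_span_eq_idealC₀ hU x
  obtain ⟨ϖ, hϖ⟩ := hU.exists_span_eq (R.π x)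
  have hpb := R.pb_algebraMap x ϖ
  have hϖm : R.π.stalkMap x ϖ ∈ IsLocalRing.maximalIdeal (R.X.presheaf.stalk x) :=
    IsLocalRing.map_maximalIdeal_le (R.π.stalkMap x).hom
      (Ideal.mem_map_of_mem _ (hϖ ▸ Ideal.mem_span_singleton_self ϖ))
  have hϖ0 : R.π.stalkMap x ϖ ≠ 0 := by
    rw [← map_ne_zero_iff _ (IsFractionRing.injective _ R.X.functionField), ← hpb]
    exact pb_uniformizer_ne_zero hx ⟨ϖ, hϖ, rfl⟩
  have hγ0 : algebraMap (R.X.presheaf.stalk x) R.X.functionField g ≠ 0 :=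
    (map_ne_zero_iff _ (IsFractionRing.injective _ _)).mpr hg0
  obtain ⟨m, hm⟩ := exists_lower_bound_of_mul_zpow_mem_range hϖm hϖ0
    (mul_ne_zero hf0 (zpow_ne_zero b hγ0))
  refine ⟨m, fun n hn => hm n ?_⟩
  have hreg := hn _ ⟨1, _, _, ⟨g, hg, rfl⟩, ⟨ϖ, hϖ, rfl⟩, rfl⟩
  rwa [Units.val_one, map_one, one_mul, hpb, ← mul_assoc] at hreg

end RuledSurface

/-! ### Restriction of rational functions -/

section Restricts

variable {X Y : Scheme.{u}} [IsIntegral X] [IsIntegral Y]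

/-- The rational function `φ` on `X` is regular at the image of the generic point of `Y`, and its
restriction along `ι` is the rational function `φ'` on `Y`. -/
def Restricts (ι : Y ⟶ X) (φ : X.functionField) (φ' : Y.functionField) : Prop :=
  ∃ w : X.presheaf.stalk (ι (genericPoint Y)),
    algebraMap _ X.functionField w = φ ∧ ι.stalkMap (genericPoint Y) w = φ'

theorem restricts_algebraMap (ι : Y ⟶ X) (y : Y) (u : X.presheaf.stalk (ι y)) :
    Restricts ι (algebraMap _ _ u) (algebraMap _ _ (ι.stalkMap y u)) := by
  have h : genericPoint Y ⤳ y := (genericPoint_spec Y).specializes trivial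
  exact ⟨X.presheaf.stalkSpecializes (h.map ι.continuous) u, algebraMap_stalkSpecializes _ _,
    congrArg (fun ψ => ψ.hom u) (ι.stalkSpecializes_stalkMap _ _ h)⟩

namespace Restricts

variable {ι : Y ⟶ X} {φ ψ : X.functionField} {φ' ψ' : Y.functionField}

theorem mul (h : Restricts ι φ φ') (h' : Restricts ι ψ ψ') : Restricts ι (φ * ψ) (φ' * ψ') := by
  obtain ⟨w, rfl, rfl⟩ := h
  obtain ⟨v, rfl, rfl⟩ := h'
  exact ⟨w * v, map_mul _ _ _, map_mul _ _ _⟩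

theorem zpow (h : Restricts ι φ φ') (h0 : φ' ≠ 0) (n : ℤ) : Restricts ι (φ ^ n) (φ' ^ n) := by
  obtain ⟨w, rfl, rfl⟩ := h
  obtain ⟨w, rfl⟩ := isUnit_of_map_unit (ι.stalkMap (genericPoint Y)).hom w
    (isUnit_iff_ne_zero (G₀ := Y.functionField).mpr h0)
  exact ⟨(w ^ n : (X.presheaf.stalk (ι (genericPoint Y)))ˣ), map_units_zpow _ w n,
    map_units_zpow (L := Y.functionField) (ι.stalkMap (genericPoint Y)).hom w n⟩

theorem unique (h : Restricts ι φ φ') (h' : Restricts ι φ ψ') : φ' = ψ' := by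
  obtain ⟨w, hw, rfl⟩ := h
  obtain ⟨v, hv, rfl⟩ := h'
  rw [IsFractionRing.injective _ X.functionField (hw.trans hv.symm)]

theorem ne_zero (h : Restricts ι φ φ') (h0 : φ' ≠ 0) : φ ≠ 0 := by
  obtain ⟨w, rfl, rfl⟩ := h
  rw [map_ne_zero_iff _ (IsFractionRing.injective _ _)]
  rintro rfl
  exact h0 (map_zero _)

end Restricts

end Restricts

/-! ### Sections along a fibre -/

namespace RuledSurface

variable {k : Type u} [Field k] {R : RuledSurface k}

theorem isEquationAt_of_notMem_range {x : R.X} (hx : x ∉ Set.range R.σ) (b n : ℤ)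
    {s : R.C.functionField}
    (hs : GeneratesIdeal (IsLocalRing.maximalIdeal (R.C.presheaf.stalk (R.π x))) s) :
    R.IsEquationAt b n x (R.pb s ^ n) :=
  ⟨1, 1, s, ⟨1, by rw [Ideal.span_singleton_one, R.idealC₀_eq_top hx], map_one _⟩, hs, by simp⟩

theorem fiberι_mem_range_σ_iff {y : R.C} {z : R.π.fiber y} :
    R.π.fiberι y z ∈ Set.range R.σ ↔ z = (R.fiberPoint y).1 := by
  refine ⟨fun ⟨y', hy'⟩ => (R.π.fiberι y).isEmbedding.injective ?_, fun h => ⟨y, ?_⟩⟩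
  · obtain rfl : y' = y := by rw [← fiberι_apply R.π y z, ← hy', R.π_σ]
    rw [← hy', fiberι_fiberPoint]
  · rw [h, fiberι_fiberPoint]

theorem exists_isEquationAt_fiberι (b n : ℤ) {y : R.C} {s : R.C.functionField}
    (hs : GeneratesIdeal (IsLocalRing.maximalIdeal (R.C.presheaf.stalk y)) s)
    {γ : R.X.functionField}
    (hγ : GeneratesIdeal (R.idealC₀ (R.π.fiberι y (R.fiberPoint y).1)) γ) :
    ∃ t : R.π.fiber y → R.X.functionField,
      (∀ z, R.IsEquationAt b n (R.π.fiberι y z) (t z)) ∧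
      (∀ z ≠ (R.fiberPoint y).1, t z = R.pb s ^ n) ∧
      t (R.fiberPoint y).1 = γ ^ b * R.pb s ^ n := by
  classical
  refine ⟨Function.update (fun _ => R.pb s ^ n) (R.fiberPoint y).1 (γ ^ b * R.pb s ^ n),
    fun z => ?_, fun z hz => Function.update_of_ne hz _ _, Function.update_self ..⟩
  have hs' : GeneratesIdeal
      (IsLocalRing.maximalIdeal (R.C.presheaf.stalk (R.π (R.π.fiberι y z)))) s := by
    rwa [fiberι_apply]
  by_cases hz : z = (R.fiberPoint y).1
  · subst hz
    rw [Function.update_self]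
    exact ⟨1, γ, s, hγ, hs', by rw [Units.val_one, map_one, one_mul]⟩
  · rw [Function.update_of_ne hz]
    exact isEquationAt_of_notMem_range (fiberι_mem_range_σ_iff.not.mpr hz) b n hs'

theorem exists_germs_on_fiber (hU : R.HasUniformizers) {y : R.C}
    [IsIntegral (R.π.fiber y)] {b n : ℤ} {f : R.X.functionField} (hf : R.IsRegularOnFiber b n y f)
    {g : R.X.presheaf.stalk (R.π.fiberι y (R.fiberPoint y).1)}
    (hg : Ideal.span {g} = R.idealC₀ _)
    (hg0 : (R.π.fiberι y).stalkMap (R.fiberPoint y).1 g ≠ 0)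
    (hξ : genericPoint (R.π.fiber y) ≠ (R.fiberPoint y).1) :
    ∃ (u : ∀ z : R.π.fiber y, R.X.presheaf.stalk (R.π.fiberι y z))
      (ψ : (R.π.fiber y).functionField),
      (∀ z, ∃ t, R.IsEquationAt b n (R.π.fiberι y z) t ∧
        algebraMap _ R.X.functionField (u z) = f * t) ∧
      (∀ z ≠ (R.fiberPoint y).1,
        algebraMap _ (R.π.fiber y).functionField ((R.π.fiberι y).stalkMap z (u z)) = ψ) ∧
      algebraMap _ (R.π.fiber y).functionField
          ((R.π.fiberι y).stalkMap (R.fiberPoint y).1 (u (R.fiberPoint y).1)) =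
        ψ * algebraMap _ (R.π.fiber y).functionField
          ((R.π.fiberι y).stalkMap (R.fiberPoint y).1 g) ^ b := by
  obtain ⟨s, hs⟩ := hU.exists_generatesIdeal y
  obtain ⟨t, ht, hne, hz₀⟩ := exists_isEquationAt_fiberι b n hs ⟨g, hg, rfl⟩
  choose u hu using fun z => hf _ (fiberι_apply R.π y z) _ (ht z)
  have hres (z : R.π.fiber y) := restricts_algebraMap (R.π.fiberι y) z (u z)
  obtain ⟨ψ, hψ⟩ : ∃ ψ, Restricts (R.π.fiberι y) (f * R.pb s ^ n) ψ :=
    ⟨_, hne _ hξ ▸ hu (genericPoint (R.π.fiber y)) ▸ hres _⟩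
  refine ⟨u, ψ, fun z => ⟨_, ht z, hu z⟩, fun z hz => ?_, ?_⟩
  · have hz' := hres z
    rw [hu, hne z hz] at hz'
    exact hz'.unique hψ
  · have hz' := hres (R.fiberPoint y).1
    rw [hu, hz₀, mul_left_comm, mul_comm] at hz'
    refine hz'.unique (hψ.mul ((restricts_algebraMap (R.π.fiberι y) _ g).zpow ?_ b))
    exact (map_ne_zero_iff _ (IsFractionRing.injective _ _)).mpr hg0

theorem isRegularAt_sub_one_of_fiberι_stalkMap_eq_zero [PerfectField k] {y : R.C}
    (hy : IsClosed ({y} : Set R.C)) {b n : ℤ} {z : R.π.fiber y} {f t : R.X.functionField}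
    (ht : R.IsEquationAt b n (R.π.fiberι y z) t) {u : R.X.presheaf.stalk (R.π.fiberι y z)}
    (hu : algebraMap _ R.X.functionField u = f * t) (h0 : (R.π.fiberι y).stalkMap z u = 0) :
    R.IsRegularAt b (n - 1) (R.π.fiberι y z) f := by
  obtain ⟨w, γ, s, hγ, hs, rfl⟩ := ht
  have hs0 : R.pb s ≠ 0 := pb_uniformizer_ne_zero ((fiberι_apply R.π y z).symm ▸ hy) hs
  refine (isRegularAt_iff ⟨w, γ, s, hγ, hs, rfl⟩).mpr ?_
  obtain ⟨ϖ, hϖ, rfl⟩ := hs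
  have hmem : u ∈ RingHom.ker ((R.π.fiberι y).stalkMap z).hom := h0
  rw [ker_fiberι_stalkMap, ← hϖ, Ideal.map_span, Set.image_singleton] at hmem
  obtain ⟨d, rfl⟩ := Ideal.mem_span_singleton'.mp hmem
  refine ⟨d, mul_right_cancel₀ hs0 ?_⟩
  rw [map_mul] at hu
  rw [zpow_sub_one₀ hs0, R.pb_algebraMap] at *
  exact hu.trans (by field_simp)

theorem encard_fiber_zeros_le [PerfectField k] (hU : R.HasUniformizers) {y : R.C}
    (hy : IsClosed ({y} : Set R.C)) {b n : ℤ} {f : R.X.functionField}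
    (hf : R.IsRegularOnFiber b n y f) (hf' : ¬ R.IsRegularOnFiber b (n - 1) y f) :
    0 ≤ b ∧ {z : RationalPoint (fiberStr R.π y) |
      ¬ R.IsUnitAt b n (R.π.fiberι y z.1) f}.encard ≤ b.toNat := by
  obtain ⟨D⟩ := nonempty_projLineCharts (R.fiber_projLine y hy)
  have := D.isIntegral
  obtain ⟨g, hg, hg0, hgm⟩ := exists_fiber_equation hU hy
  have hξ : genericPoint (R.π.fiber y) ≠ (R.fiberPoint y).1 := by
    intro h
    have hbot : IsLocalRing.maximalIdeal
        ((R.π.fiber y).presheaf.stalk (R.fiberPoint y).1) = ⊥ := h ▸ maximalIdeal_genericPoint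
    rw [← hgm, Ideal.span_singleton_eq_bot] at hbot
    exact hg0 hbot
  obtain ⟨u, ψ, hu, hne, hz₀⟩ := exists_germs_on_fiber hU hf hg hg0 hξ
  have hψ : ψ ≠ 0 := by
    rintro rfl
    refine hf' fun x hx => ?_
    obtain ⟨z, rfl⟩ := exists_fiberι_eq R.π y hx
    obtain ⟨t, ht, hut⟩ := hu z
    refine isRegularAt_sub_one_of_fiberι_stalkMap_eq_zero hy ht hut ?_
    apply IsFractionRing.injective _ (R.π.fiber y).functionField
    rw [map_zero]
    by_cases hz : z = (R.fiberPoint y).1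
    · rw [hz, hz₀, zero_mul]
    · exact hne z hz
  obtain ⟨hb, hle⟩ := D.zeros_le (R.fiberPoint y) _ hgm ψ hψ b
    (fun z => (R.π.fiberι y).stalkMap z (u z)) hne hz₀
  refine ⟨hb, le_trans (Set.encard_le_encard ?_) hle⟩
  intro z hz hunit
  apply hz
  obtain ⟨t, ht, hut⟩ := hu z.1
  obtain ⟨w, hw⟩ := isUnit_of_map_unit ((R.π.fiberι y).stalkMap z.1).hom _ hunit
  exact ⟨t, w, ht, hw ▸ hut⟩

theorem nonneg_of_mem_sections [PerfectField k] (hU : R.HasUniformizers) {b : ℤ}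
    {𝔟 : CurveDivisor R.C} {f : R.X.functionField} (hf : f ∈ R.sections b 𝔟) (hf0 : f ≠ 0) :
    0 ≤ b := by
  obtain ⟨y, hy, -⟩ := exists_isClosed_specializes R.C (genericPoint R.C)
  obtain ⟨m, hm⟩ := exists_lower_bound_isRegularAt hU (x := R.σ y) ((R.π_σ y).symm ▸ hy) b hf0
  obtain ⟨n, hn, hmin⟩ := Int.exists_least_of_bdd (P := fun n => R.IsRegularOnFiber b n y f)
    ⟨m, fun n hn => hm n (hn _ (R.π_σ y))⟩ ⟨_, isRegularOnFiber_of_mem_sections hf y⟩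
  exact (encard_fiber_zeros_le hU hy hn fun h => (hmin _ h).not_gt (sub_one_lt n)).1

end RuledSurface

/-! ### Divisors on the base curve -/

section CurveDivisor

variable {C : Scheme.{u}}

theorem coeff_of_not_isClosed {y : C} (hy : ¬ IsClosed ({y} : Set C)) (𝔟 : CurveDivisor C) :
    coeff 𝔟 y = 0 :=
  dif_neg hy

theorem coeff_add (𝔟 𝔠 : CurveDivisor C) (y : C) : coeff (𝔟 + 𝔠) y = coeff 𝔟 y + coeff 𝔠 y := by
  unfold coeff
  split_ifs
  · exact Finsupp.add_apply _ _ _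
  · rw [add_zero]

theorem coeff_sub (𝔟 𝔠 : CurveDivisor C) (y : C) : coeff (𝔟 - 𝔠) y = coeff 𝔟 y - coeff 𝔠 y :=
  eq_sub_of_add_eq (by rw [← coeff_add, sub_add_cancel])

theorem coeff_smul (c : ℤ) (𝔟 : CurveDivisor C) (y : C) : coeff (c • 𝔟) y = c * coeff 𝔟 y := by
  unfold coeff
  split_ifs
  · exact Finsupp.smul_apply _ _ _
  · rw [mul_zero]

theorem degree_add {k : Type u} [Field k] (s : C ⟶ Spec (.of k)) (𝔟 𝔠 : CurveDivisor C) :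
    degree s (𝔟 + 𝔠) = degree s 𝔟 + degree s 𝔠 :=
  Finsupp.sum_add_index' (fun _ => zero_mul _) (fun _ _ _ => add_mul _ _ _)

theorem degree_sub {k : Type u} [Field k] (s : C ⟶ Spec (.of k)) (𝔟 𝔠 : CurveDivisor C) :
    degree s (𝔟 - 𝔠) = degree s 𝔟 - degree s 𝔠 :=
  eq_sub_of_add_eq (by rw [← degree_add, sub_add_cancel])

theorem degree_smul {k : Type u} [Field k] (s : C ⟶ Spec (.of k)) (c : ℤ) (𝔟 : CurveDivisor C) :
    degree s (c • 𝔟) = c * degree s 𝔟 := by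
  unfold degree
  rw [Finsupp.sum_smul_index' fun _ => zero_mul _, Finsupp.mul_sum]
  simp only [smul_eq_mul, mul_assoc]

end CurveDivisor

namespace RuledSurface

variable {k : Type u} [Field k] {R : RuledSurface k}

namespace IsCurveEquation

variable {𝔟 𝔠 : CurveDivisor R.C} {p : R.C} {t t' : R.C.functionField}

theorem ne_zero [PerfectField k] (h : R.IsCurveEquation 𝔟 p t) : t ≠ 0 := by
  obtain ⟨w, ϖ, hϖ, rfl⟩ := h
  refine mul_ne_zero (w.isUnit.map _).ne_zero ?_
  by_cases hp : IsClosed ({p} : Set R.C)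
  · exact zpow_ne_zero _ ((map_ne_zero_iff _ (IsFractionRing.injective _ _)).mpr
      (uniformizer_ne_zero hp hϖ))
  · rw [coeff_of_not_isClosed hp, zpow_zero]
    exact one_ne_zero

theorem mul [PerfectField k] (h : R.IsCurveEquation 𝔟 p t) (h' : R.IsCurveEquation 𝔠 p t') :
    R.IsCurveEquation (𝔟 + 𝔠) p (t * t') := by
  obtain ⟨w, ϖ, hϖ, rfl⟩ := h
  obtain ⟨w', ϖ', hϖ', rfl⟩ := h'
  obtain ⟨v, rfl⟩ := Ideal.span_singleton_eq_span_singleton.mp (hϖ.trans hϖ'.symm)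
  refine ⟨w * w' * v ^ coeff 𝔠 p, ϖ, hϖ, ?_⟩
  have hzpow : algebraMap (R.C.presheaf.stalk p) R.C.functionField ϖ ≠ 0 ∨
      coeff 𝔟 p + coeff 𝔠 p ≠ 0 ∨ coeff 𝔟 p = 0 ∧ coeff 𝔠 p = 0 := by
    by_cases hp : IsClosed ({p} : Set R.C)
    · exact Or.inl ((map_ne_zero_iff _ (IsFractionRing.injective _ _)).mpr
        (uniformizer_ne_zero hp hϖ))
    · exact Or.inr (Or.inr ⟨coeff_of_not_isClosed hp _, coeff_of_not_isClosed hp _⟩)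
  rw [coeff_add, zpow_add' hzpow]
  simp only [Units.val_mul, map_mul, mul_zpow, map_units_zpow]
  ring

theorem zpow (h : R.IsCurveEquation 𝔟 p t) (c : ℤ) : R.IsCurveEquation (c • 𝔟) p (t ^ c) := by
  obtain ⟨w, ϖ, hϖ, rfl⟩ := h
  refine ⟨w ^ c, ϖ, hϖ, ?_⟩
  rw [coeff_smul, mul_zpow, map_units_zpow, ← zpow_mul, mul_comm c]

theorem isEquationAt {x : R.X} (h : R.IsCurveEquation 𝔟 (R.π x) t) {γ : R.X.functionField}
    (hγ : GeneratesIdeal (R.idealC₀ x) γ) (b : ℤ) :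
    R.IsEquationAt b (coeff 𝔟 (R.π x)) x (γ ^ b * R.pb t) := by
  obtain ⟨w, ϖ, hϖ, rfl⟩ := h
  refine ⟨Units.map (R.π.stalkMap x).hom w, γ, _, hγ, ⟨ϖ, hϖ, rfl⟩, ?_⟩
  rw [map_mul, map_zpow₀, R.pb_algebraMap x w]
  exact (mul_left_comm _ _ _).trans (mul_assoc _ _ _).symm

end IsCurveEquation

theorem HasUniformizers.exists_isCurveEquation (hU : R.HasUniformizers) (𝔟 : CurveDivisor R.C)
    (p : R.C) : ∃ t, R.IsCurveEquation 𝔟 p t := by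
  obtain ⟨ϖ, hϖ⟩ := hU.exists_span_eq p
  exact ⟨_, 1, ϖ, hϖ, rfl⟩

theorem IsNormalized.degree_nonneg [PerfectField k] (hR : R.IsNormalized) (hU : R.HasUniformizers)
    {𝔠 : CurveDivisor R.C} {φ : R.C.functionField} (hφ : φ ≠ 0)
    (h : ∀ p, ∃ t, R.IsCurveEquation 𝔠 p t ∧
      φ * t ∈ (algebraMap (R.C.presheaf.stalk p) R.C.functionField).range) :
    0 ≤ degree R.strC 𝔠 := by
  by_contra! hneg
  have hmem : R.pb φ ∈ R.sections 1 𝔠 := by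
    refine mem_sections_iff.mpr fun x => ?_
    obtain ⟨g, -, hg⟩ := exists_span_eq_idealC₀ hU x
    obtain ⟨t, ht, a, ha⟩ := h (R.π x)
    refine (isRegularAt_iff (ht.isEquationAt ⟨g, hg, rfl⟩ 1)).mpr ⟨g * R.π.stalkMap x a, ?_⟩
    rw [map_mul, ← R.pb_algebraMap, ha, map_mul, zpow_one, mul_left_comm]
  rw [hR.2 𝔠 hneg, Submodule.mem_bot, map_eq_zero] at hmem
  exact hφ hmem

/-! ### Restriction to the section -/

theorem algebraMap_stalkMap_of_eq_id {C : Scheme.{u}} [IsIntegral C] {φ : C ⟶ C} (h : φ = 𝟙 C)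
    (p : C) (a : C.presheaf.stalk (φ p)) :
    algebraMap _ C.functionField (φ.stalkMap p a) = algebraMap _ C.functionField a := by
  subst h
  rw [Scheme.Hom.stalkMap_id]
  rfl

theorem restricts_pb (s : R.C.functionField) : Restricts R.σ (R.pb s) s := by
  obtain ⟨a, rfl⟩ : ∃ a, algebraMap (R.C.presheaf.stalk (R.π (R.σ (genericPoint R.C))))
      R.C.functionField a = s := by
    rw [R.π_σ]
    exact ⟨s, congrArg (fun ψ => ψ.hom s) (R.C.presheaf.stalkSpecializes_refl _)⟩
  have hid := algebraMap_stalkMap_of_eq_id R.σ_π (genericPoint R.C) a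
  rw [Scheme.Hom.stalkMap_comp] at hid
  have h := restricts_algebraMap R.σ (genericPoint R.C) (R.π.stalkMap _ a)
  rw [← R.pb_algebraMap] at h
  exact hid ▸ h

theorem generatesIdeal_idealC₀_of_specializes {y p : R.C} (h : y ⤳ p) {γ : R.X.functionField}
    (hγ : GeneratesIdeal (R.idealC₀ (R.σ p)) γ) : GeneratesIdeal (R.idealC₀ (R.σ y)) γ := by
  obtain ⟨g, hg, rfl⟩ := hγ
  refine ⟨_, ?_, algebraMap_stalkSpecializes (h.map R.σ.continuous) g⟩
  rw [idealC₀_σ] at hg ⊢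
  rw [← map_stalkSpecializes_ker_stalkMap R.σ h, ← hg, Ideal.map_span, Set.image_singleton]

theorem SelfIntersection.exists_restricts [PerfectField k] {m : ℤ} (h : R.SelfIntersection m) :
    ∃ (r : R.X.functionField) (𝔡 : CurveDivisor R.C), degree R.strC 𝔡 = m ∧
      ∀ p, ∃ γ t, GeneratesIdeal (R.idealC₀ (R.σ p)) γ ∧ Restricts R.σ (r * γ) t ∧
        R.IsCurveEquation 𝔡 p t := by
  have hU := h.hasUniformizers
  obtain ⟨r, 𝔡, h𝔡, hr⟩ := h
  have hclosed (p : R.C) (hp : IsClosed ({p} : Set R.C)) :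
      ∃ γ t, GeneratesIdeal (R.idealC₀ (R.σ p)) γ ∧ Restricts R.σ (r * γ) t ∧
        R.IsCurveEquation 𝔡 p t := by
    obtain ⟨g, u, v, hg, hguv, -, hv0, ht⟩ := hr p hp
    have hv0' : algebraMap _ R.C.functionField (R.σ.stalkMap p v) ≠ 0 :=
      (map_ne_zero_iff _ (IsFractionRing.injective _ _)).mpr hv0
    have hv := restricts_algebraMap R.σ p v
    have huv := (restricts_algebraMap R.σ p u).mul (hv.zpow hv0' (-1))
    rw [← hguv, zpow_neg_one, zpow_neg_one, mul_inv_cancel_right₀ (hv.ne_zero hv0')] at huv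
    exact ⟨_, _, ⟨g, hg, rfl⟩, huv, div_eq_mul_inv (G := R.C.functionField) _ _ ▸ ht⟩
  refine ⟨r, 𝔡, h𝔡, fun p => ?_⟩
  by_cases hp : IsClosed ({p} : Set R.C)
  · exact hclosed p hp
  obtain ⟨q, hq, hpq⟩ := exists_isClosed_specializes R.C p
  obtain ⟨γ, t, hγ, hrγ, ht⟩ := hclosed q hq
  have hγ' := generatesIdeal_idealC₀_of_specializes hpq hγ
  obtain rfl := hU.eq_genericPoint hp
  refine ⟨γ, t, hγ', hrγ, Units.mk0 t ht.ne_zero, 0, ?_, ?_⟩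
  · rw [maximalIdeal_genericPoint, Ideal.span_singleton_eq_bot]
  · rw [coeff_of_not_isClosed hp, zpow_zero, mul_one]
    exact (congrArg (fun ψ => ψ.hom t) (R.C.presheaf.stalkSpecializes_refl _)).symm

theorem exists_restricts_of_isRegularAt {p : R.C} {γ r f : R.X.functionField}
    (hγ : GeneratesIdeal (R.idealC₀ (R.σ p)) γ) {t : R.C.functionField}
    (hr : Restricts R.σ (r * γ) t) (ht : t ≠ 0) {𝔟 : CurveDivisor R.C} {β : R.C.functionField}
    (hβ : R.IsCurveEquation 𝔟 p β) (hβ0 : β ≠ 0) {c : ℤ}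
    (hf : R.IsRegularAt c (coeff 𝔟 (R.π (R.σ p))) (R.σ p) f) :
    ∃ a : R.C.presheaf.stalk p,
      Restricts R.σ (f * r ^ (-c)) (algebraMap _ R.C.functionField a * (β * t ^ c)⁻¹) ∧
      (a = 0 → R.IsRegularAt (c - 1) (coeff 𝔟 (R.π (R.σ p))) (R.σ p) f) := by
  have hβ' : R.IsCurveEquation 𝔟 (R.π (R.σ p)) β := (R.π_σ p).symm ▸ hβ
  have hγ0 : γ ≠ 0 := right_ne_zero_of_mul (hr.ne_zero ht)
  have hpb0 : R.pb β ≠ 0 := (map_ne_zero _).mpr hβ0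
  obtain ⟨u, hu⟩ := hf _ (hβ'.isEquationAt hγ c)
  refine ⟨R.σ.stalkMap p u, ?_, fun h0 => ?_⟩
  · have h := ((restricts_algebraMap R.σ p u).mul ((restricts_pb β).zpow hβ0 (-1))).mul
      (hr.zpow ht (-c))
    rw [hu] at h
    convert h using 1
    · rw [zpow_neg_one, mul_zpow, ← mul_assoc f, mul_inv_cancel_right₀ hpb0, mul_mul_mul_comm,
        zpow_neg γ, mul_inv_cancel₀ (zpow_ne_zero c hγ0), mul_one]
    · rw [mul_inv, zpow_neg_one, zpow_neg, mul_assoc]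
  · obtain ⟨g, hg, rfl⟩ := hγ
    have hmem : u ∈ R.idealC₀ (R.σ p) := R.idealC₀_σ p ▸ h0
    rw [← hg] at hmem
    obtain ⟨d, rfl⟩ := Ideal.mem_span_singleton'.mp hmem
    refine (isRegularAt_iff (hβ'.isEquationAt ⟨g, hg, rfl⟩ (c - 1))).mpr
      ⟨d, mul_right_cancel₀ hγ0 ?_⟩
    rw [← map_mul, hu, zpow_sub_one₀ hγ0]
    field_simp

theorem mem_sections_sub_one {c : ℤ} {𝔟 : CurveDivisor R.C} {f : R.X.functionField}
    (hU : R.HasUniformizers) (hf : f ∈ R.sections c 𝔟)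
    (h : ∀ p, R.IsRegularAt (c - 1) (coeff 𝔟 (R.π (R.σ p))) (R.σ p) f) :
    f ∈ R.sections (c - 1) 𝔟 := by
  refine mem_sections_iff.mpr fun x => ?_
  by_cases hx : x ∈ Set.range R.σ
  · obtain ⟨p, rfl⟩ := hx
    exact h p
  · obtain ⟨s, hs⟩ := hU.exists_generatesIdeal (R.π x)
    rw [isRegularAt_iff (isEquationAt_of_notMem_range hx _ _ hs)]
    exact mem_sections_iff.mp hf x _ (isEquationAt_of_notMem_range hx _ _ hs)

theorem IsNormalized.degree_nonneg_of_mem_sections [PerfectField k] (hR : R.IsNormalized) {e : ℤ}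
    (hRe : R.HasInvariant e) (he : 0 ≤ e) {b : ℤ} {𝔟 : CurveDivisor R.C} {f : R.X.functionField}
    (hf : f ∈ R.sections b 𝔟) (hf0 : f ≠ 0) : 0 ≤ degree R.strC 𝔟 := by
  have hU : R.HasUniformizers := SelfIntersection.hasUniformizers hRe
  obtain ⟨c, hc, hmin⟩ := Int.exists_least_of_bdd (P := fun c => f ∈ R.sections c 𝔟)
    ⟨0, fun c hc => nonneg_of_mem_sections hU hc hf0⟩ ⟨b, hf⟩
  obtain ⟨r, 𝔡, h𝔡, hr⟩ := SelfIntersection.exists_restricts hRe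
  have hlocal (p : R.C) : ∃ (t : R.C.functionField) (a : R.C.presheaf.stalk p),
      R.IsCurveEquation (𝔟 + c • 𝔡) p t ∧
      Restricts R.σ (f * r ^ (-c)) (algebraMap _ R.C.functionField a * t⁻¹) ∧
      (a = 0 → R.IsRegularAt (c - 1) (coeff 𝔟 (R.π (R.σ p))) (R.σ p) f) := by
    obtain ⟨γ, t, hγ, hrγ, ht⟩ := hr p
    obtain ⟨β, hβ⟩ := hU.exists_isCurveEquation 𝔟 p
    obtain ⟨a, ha⟩ := exists_restricts_of_isRegularAt hγ hrγ ht.ne_zero hβ hβ.ne_zero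
      (mem_sections_iff.mp hc (R.σ p))
    exact ⟨_, a, hβ.mul (ht.zpow c), ha⟩
  choose t a ht hres hzero using hlocal
  obtain ⟨φ, hresφ⟩ : ∃ φ, Restricts R.σ (f * r ^ (-c)) φ := ⟨_, hres (genericPoint R.C)⟩
  have hφ (p : R.C) : φ * t p = algebraMap _ R.C.functionField (a p) := by
    rw [hresφ.unique (hres p), inv_mul_cancel_right₀ (ht p).ne_zero]
  have hφ0 : φ ≠ 0 := fun h0 => by
    refine (hmin _ (mem_sections_sub_one hU hc fun p => hzero p ?_)).not_gt (sub_one_lt c)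
    apply IsFractionRing.injective _ R.C.functionField
    rw [← hφ, h0, zero_mul, map_zero]
  have hdeg := hR.degree_nonneg hU hφ0 fun p => ⟨t p, ht p, a p, (hφ p).symm⟩
  rw [degree_add, degree_smul, h𝔡] at hdeg
  linarith [mul_nonneg (nonneg_of_mem_sections hU hc hf0) he]

end RuledSurface

/-! ### Rational points of a scheme of finite type over a finite field -/

section RationalPoints

variable {k : Type u} [Field k] {C : Scheme.{u}} (s : C ⟶ Spec (.of k))

theorem isClosed_of_isRational [IsSeparated s] {y : C}
    (hy : Function.Bijective (residueScalarHom s y)) : IsClosed ({y} : Set C) := by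
  have : IsIso (CommRingCat.ofHom (residueScalarHom s y)) :=
    (ConcreteCategory.isIso_iff_bijective _).mpr hy
  have : IsProper (C.fromSpecResidueField y ≫ s) := by
    rw [fromSpecResidueField_comp]
    infer_instance
  have : IsProper (C.fromSpecResidueField y) := IsProper.of_comp _ s
  rw [← Scheme.range_fromSpecResidueField]
  exact (C.fromSpecResidueField y).isClosedMap.isClosed_range

theorem residueDegree_eq_one {y : C} (hy : Function.Bijective (residueScalarHom s y)) :
    s.residueDegree y = 1 := by
  let _ := (s.residueFieldMap y).hom.toAlgebra
  have hsurj : Function.Surjective (s.residueFieldMap y) := fun z => by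
    obtain ⟨c, rfl⟩ := hy.2 z
    refine ⟨residueScalarHom (𝟙 _) (s y) c, ?_⟩
    rw [residueFieldMap_residueScalarHom, Category.comp_id]
  have e := LinearEquiv.ofBijective (Algebra.linearMap (((Spec (.of k)).residueField (s y)))
    (C.residueField y)) ⟨(s.residueFieldMap y).hom.injective, hsurj⟩
  exact e.symm.finrank_eq.trans (Module.finrank_self _)

theorem finiteType_sectionScalarHom [LocallyOfFiniteType s] {U : C.Opens} (hU : IsAffineOpen U) :
    (sectionScalarHom s U).FiniteType :=
  (s.finiteType_appLE (isAffineOpen_top _) hU le_top).comp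
    (RingHom.FiniteType.of_surjective _
      (ConcreteCategory.bijective_of_isIso (Scheme.ΓSpecIso (.of k)).inv).2)

variable {s} in
theorem rationalPoint_ext {U : C.Opens} (hU : IsAffineOpen U) {P Q : RationalPoint s}
    (hP : P.1 ∈ U) (hQ : Q.1 ∈ U)
    (h : ∀ a, value s P (C.presheaf.germ U P.1 hP a) = value s Q (C.presheaf.germ U Q.1 hQ a)) :
    P = Q := by
  have hmem {P : RationalPoint s} (hP : P.1 ∈ U) (a : Γ(C, U)) :
      a ∈ (hU.primeIdealOf ⟨P.1, hP⟩).asIdeal ↔ value s P (C.presheaf.germ U P.1 hP a) = 0 :=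
    not_iff_not.mp ((isUnit_germ_iff hU hP a).symm.trans
      (not_not.symm.trans (value_eq_zero_iff P _).not.symm))
  have hprime : (hU.primeIdealOf ⟨P.1, hP⟩).asIdeal = (hU.primeIdealOf ⟨Q.1, hQ⟩).asIdeal :=
    Ideal.ext fun a => by rw [hmem hP, hmem hQ, h]
  exact Subtype.ext ((specializes_of_primeIdealOf_le hU hP hQ hprime.le).antisymm
    (specializes_of_primeIdealOf_le hU hQ hP hprime.ge)).eq

theorem finite_rationalPoint_mem [Finite k] [LocallyOfFiniteType s] {U : C.Opens}
    (hU : IsAffineOpen U) : {P : RationalPoint s | P.1 ∈ U}.Finite := by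
  let _ := (sectionScalarHom s U).toAlgebra
  have hft : Algebra.FiniteType k Γ(C, U) := finiteType_sectionScalarHom s hU
  obtain ⟨S, hS⟩ := hft.1
  let ev (P : {P : RationalPoint s | P.1 ∈ U}) : Γ(C, U) →ₐ[k] k :=
    { (value s P.1).comp (C.presheaf.germ U P.1.1 P.2).hom with
      commutes' := fun c => by
        change value s P.1 (C.presheaf.germ U P.1.1 P.2 (sectionScalarHom s U c)) = c
        rw [germ_sectionScalarHom, value_scalarHom] }
  refine Finite.of_injective (β := S → k) (fun P a => ev P a.1) fun P Q h => ?_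
  have hPQ : ev P = ev Q := AlgHom.ext_of_adjoin_eq_top hS fun a ha => congrFun h ⟨a, ha⟩
  exact Subtype.ext (rationalPoint_ext hU P.2 Q.2 (DFunLike.congr_fun hPQ))

theorem finite_rationalPoint [Finite k] [LocallyOfFiniteType s] [CompactSpace C] :
    Finite (RationalPoint s) := by
  choose U hU hxU _ using fun x : C =>
    exists_isAffineOpen_mem_and_subset (X := C) (x := x) (U := ⊤) trivial
  obtain ⟨t, ht⟩ := isCompact_univ.elim_finite_subcover (fun x => (U x : Set C))
    (fun x => (U x).2) fun x _ => Set.mem_iUnion.mpr ⟨x, hxU x⟩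
  have hfin : (⋃ x ∈ t, {P : RationalPoint s | P.1 ∈ U x}).Finite :=
    t.finite_toSet.biUnion fun x _ => finite_rationalPoint_mem s (hU x)
  refine Set.finite_univ_iff.mp (hfin.subset fun P _ => ?_)
  simpa using ht (Set.mem_univ P.1)

end RationalPoints

namespace RuledSurface

variable {k : Type u} [Field k] {R : RuledSurface k}

instance [Finite k] : Finite (RationalPoint R.strC) := finite_rationalPoint R.strC

instance [Finite k] : Finite (RationalPoint R.strX) :=
  have := R.properX
  have := QuasiCompact.compactSpace_of_compactSpace R.strX
  finite_rationalPoint R.strX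

variable (R) in
/-- The map `X(k) → C(k)` induced by `π`. -/
def rationalMap (P : RationalPoint R.strX) : RationalPoint R.strC :=
  ⟨R.π P.1, isRational_of_isRational_image R.π R.π_over P.1 P.2⟩

theorem rationalMap_eq_iff {P : RationalPoint R.strX} {y : RationalPoint R.strC} :
    R.rationalMap P = y ↔ R.π P.1 = y.1 :=
  Subtype.ext_iff

theorem isClosed_rationalPoint (y : RationalPoint R.strC) : IsClosed ({y.1} : Set R.C) := by
  have := R.properC
  exact isClosed_of_isRational R.strC y.2

variable (R) in
/-- The rational points of the fibre over a rational point `y` of `C`, as rational points of `X`. -/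
def fiberRationalMap (y : RationalPoint R.strC) :
    RationalPoint (fiberStr R.π y.1) ≃ {P : RationalPoint R.strX // R.rationalMap P = y} :=
  (fiberRationalPoint R.π y.1 R.π_over y.2).trans
    (Equiv.subtypeEquivRight fun _ => rationalMap_eq_iff.symm)

theorem fiberι_of_fiberRationalMap_eq {y : RationalPoint R.strC}
    {z : RationalPoint (fiberStr R.π y.1)} {P : {P : RationalPoint R.strX // R.rationalMap P = y}}
    (h : R.fiberRationalMap y z = P) : R.π.fiberι y.1 z.1 = P.1.1 :=
  congrArg (fun Q => Q.1.1) h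

theorem card_fiber_rationalMap [Finite k] (y : RationalPoint R.strC) :
    Nat.card {P : RationalPoint R.strX // R.rationalMap P = y} = Nat.card k + 1 := by
  obtain ⟨D⟩ := nonempty_projLineCharts (R.fiber_projLine y.1 (isClosed_rationalPoint y))
  let ε : k ≃ R.C.residueField y.1 := Equiv.ofBijective _ y.2
  have := Finite.of_equiv k ε
  have hcard := ProjLineCharts.card_rationalPoint (K := R.C.residueField y.1) D
  rw [Nat.card_congr ε, ← hcard]
  exact (Nat.card_congr (R.fiberRationalMap y)).symm

theorem card_rationalPoint [Finite k] : Nat.card (RationalPoint R.strX) =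
    Nat.card (RationalPoint R.strC) * (Nat.card k + 1) := by
  have := Fintype.ofFinite (RationalPoint R.strC)
  rw [← Nat.card_congr (Equiv.sigmaFiberEquiv R.rationalMap), Nat.card_sigma,
    Finset.sum_congr rfl fun y _ => card_fiber_rationalMap y, Finset.sum_const,
    Finset.card_univ, Nat.card_eq_fintype_card (α := RationalPoint R.strC), smul_eq_mul]

/-! ### Counting zeros -/

variable (R) in
/-- A rational point of `C`, as a closed point. -/
def closedPoint (y : RationalPoint R.strC) : ClosedPoint R.C := ⟨y.1, isClosed_rationalPoint y⟩

variable (R) in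
/-- The reduced divisor on `C` supported on a finite set of rational points. -/
def sumPoints (T : Finset (RationalPoint R.strC)) : CurveDivisor R.C :=
  ∑ y ∈ T, Finsupp.single (R.closedPoint y) 1

theorem degree_sumPoints (T : Finset (RationalPoint R.strC)) :
    degree R.strC (R.sumPoints T) = T.card := by
  rw [degree, sumPoints, ← Finsupp.sum_finsetSum_index (fun _ => zero_mul _)
    (fun _ _ _ => add_mul _ _ _), Finset.cast_card]
  refine Finset.sum_congr rfl fun y _ => ?_
  rw [Finsupp.sum_single_index (zero_mul _), one_mul, closedPoint,
    residueDegree_eq_one R.strC y.2, Nat.cast_one]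

open Classical in
theorem sumPoints_apply (T : Finset (RationalPoint R.strC)) (p : ClosedPoint R.C) :
    R.sumPoints T p = if ∃ y ∈ T, y.1 = p.1 then 1 else 0 := by
  have hsingle (y : RationalPoint R.strC) :
      Finsupp.single (R.closedPoint y) (1 : ℤ) p = if y.1 = p.1 then 1 else 0 := by
    rw [Finsupp.single_apply]
    exact if_congr Subtype.ext_iff rfl rfl
  rw [sumPoints, Finsupp.finsetSum_apply, Finset.sum_congr rfl fun y _ => hsingle y]
  split_ifs with h
  · obtain ⟨y, hy, hyp⟩ := h
    rw [Finset.sum_eq_single_of_mem y hy fun z _ hz => if_neg fun hzp =>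
      hz (Subtype.ext (hzp.trans hyp.symm)), if_pos hyp]
  · exact Finset.sum_eq_zero fun y hy => if_neg fun hyp => h ⟨y, hy, hyp⟩

open Classical in
theorem coeff_sumPoints (T : Finset (RationalPoint R.strC)) (y : R.C) :
    coeff (R.sumPoints T) y = if ∃ y' ∈ T, y'.1 = y then 1 else 0 := by
  by_cases hy : IsClosed ({y} : Set R.C)
  · exact (dif_pos hy).trans (sumPoints_apply T _)
  · rw [coeff_of_not_isClosed hy, if_neg]
    rintro ⟨y', -, rfl⟩
    exact hy (isClosed_rationalPoint y')

theorem mem_sections_sub_sumPoints {b : ℤ} {𝔟 : CurveDivisor R.C} {f : R.X.functionField}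
    (hf : f ∈ R.sections b 𝔟) (T : Finset (RationalPoint R.strC))
    (hT : ∀ y ∈ T, R.IsRegularOnFiber b (coeff 𝔟 y.1 - 1) y.1 f) :
    f ∈ R.sections b (𝔟 - R.sumPoints T) := by
  refine mem_sections_iff.mpr fun x => ?_
  rw [coeff_sub, coeff_sumPoints]
  split_ifs with hx
  · obtain ⟨y, hy, hyx⟩ := hx
    exact hyx ▸ hT y hy x hyx.symm
  · rw [sub_zero]
    exact mem_sections_iff.mp hf x

theorem IsNormalized.card_le_degree [PerfectField k] (hR : R.IsNormalized) {e : ℤ}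
    (hRe : R.HasInvariant e) (he : 0 ≤ e) {b : ℤ} {𝔟 : CurveDivisor R.C} {f : R.X.functionField}
    (hf : f ∈ R.sections b 𝔟) (hf0 : f ≠ 0) (T : Finset (RationalPoint R.strC))
    (hT : ∀ y ∈ T, R.IsRegularOnFiber b (coeff 𝔟 y.1 - 1) y.1 f) :
    (T.card : ℤ) ≤ degree R.strC 𝔟 := by
  have h := hR.degree_nonneg_of_mem_sections hRe he (mem_sections_sub_sumPoints hf T hT) hf0
  rwa [degree_sub, degree_sumPoints, sub_nonneg] at h

theorem Trivialization.encard_fiber_zeros_le [PerfectField k] (hU : R.HasUniformizers) {b : ℤ}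
    {𝔟 : CurveDivisor R.C} (τ : R.Trivialization b 𝔟) (f : R.sections b 𝔟)
    {y : RationalPoint R.strC} (hy : ¬ R.IsRegularOnFiber b (coeff 𝔟 y.1 - 1) y.1 f) :
    {P | τ.germMap f P = 0 ∧ R.rationalMap P = y}.encard ≤ b.toNat := by
  refine le_trans ?_ (RuledSurface.encard_fiber_zeros_le hU (isClosed_rationalPoint y)
    (isRegularOnFiber_of_mem_sections f.2 y.1) hy).2
  refine le_trans (Set.encard_le_encard ?_)
    (Set.encard_image_le (fun z => (R.fiberRationalMap y z).1) _)
  rintro P ⟨hP, rfl⟩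
  obtain ⟨z, hz⟩ := (R.fiberRationalMap (R.rationalMap P)).surjective ⟨P, rfl⟩
  refine ⟨z, fun hunit => ?_, congrArg Subtype.val hz⟩
  have hzP : R.π.fiberι (R.rationalMap P).1 z.1 = P.1 := fiberι_of_fiberRationalMap_eq hz
  rw [hzP] at hunit
  exact (value_eq_zero_iff P (τ.germ P f)).mp hP
    (hunit.isUnit (isLocalEquation_iff.mp (τ.isLocalEquation P)) (τ.algebraMap_germ P f))

end RuledSurface

theorem ncard_le_of_ncard_fiber_le {α β : Type*} [Finite α] [Fintype β] [DecidableEq β]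
    (f : α → β) (Z : Set α) (T : Finset β) {N m : ℕ}
    (hN : ∀ y ∈ T, {x | x ∈ Z ∧ f x = y}.ncard ≤ N)
    (hm : ∀ y ∉ T, {x | x ∈ Z ∧ f x = y}.ncard ≤ m) :
    Z.ncard ≤ T.card * N + Tᶜ.card * m := by
  lift Z to Finset α using Z.toFinite
  have hcoe (y : β) : {x | x ∈ (Z : Set α) ∧ f x = y} = ({x ∈ Z | f x = y} : Finset α) := by
    simp
  simp only [hcoe, Set.ncard_coe_finset] at hN hm ⊢
  rw [Finset.card_eq_sum_card_fiberwise (fun x _ => Finset.mem_coe.mpr (Finset.mem_univ (f x))),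
    ← Finset.sum_add_sum_compl T]
  exact Nat.add_le_add (Finset.sum_le_card_nsmul _ _ _ hN)
    (Finset.sum_le_card_nsmul _ _ _ fun y hy => hm y (Finset.mem_compl.mp hy))

namespace RuledSurface

variable {k : Type u} [Field k] {R : RuledSurface k}

theorem Trivialization.ncard_zeros_le [Finite k] (hR : R.IsNormalized) {e : ℤ}
    (hRe : R.HasInvariant e) (he : 0 ≤ e) {b : ℤ} {𝔟 : CurveDivisor R.C}
    (hb : b ≤ Nat.card k + 1) (τ : R.Trivialization b 𝔟) {f : R.sections b 𝔟} (hf : f ≠ 0) :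
    ({P | τ.germMap f P = 0}.ncard : ℤ) ≤ degree R.strC 𝔟 * (Nat.card k + 1) +
      (Nat.card (RationalPoint R.strC) - degree R.strC 𝔟) * b := by
  classical
  have hU : R.HasUniformizers := SelfIntersection.hasUniformizers hRe
  have hf0 : f.1 ≠ 0 := fun h => hf (Subtype.ext h)
  have := Fintype.ofFinite (RationalPoint R.strC)
  let T : Finset (RationalPoint R.strC) :=
    {y | R.IsRegularOnFiber b (coeff 𝔟 y.1 - 1) y.1 f.1}
  have hT : (T.card : ℤ) ≤ degree R.strC 𝔟 :=
    hR.card_le_degree hRe he f.2 hf0 T fun y hy => (Finset.mem_filter.mp hy).2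
  have hin (y : RationalPoint R.strC) :
      {P | τ.germMap f P = 0 ∧ R.rationalMap P = y}.ncard ≤ Nat.card k + 1 :=
    (Set.ncard_le_ncard fun _ hP => hP.2).trans_eq (card_fiber_rationalMap y)
  have hout (y : RationalPoint R.strC) (hy : y ∉ T) :
      {P | τ.germMap f P = 0 ∧ R.rationalMap P = y}.ncard ≤ b.toNat := by
    rw [← Nat.cast_le (α := ℕ∞), Set.Finite.cast_ncard_eq (Set.toFinite _)]
    exact τ.encard_fiber_zeros_le hU f fun h =>
      hy (Finset.mem_filter.mpr ⟨Finset.mem_univ y, h⟩)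
  have hcount := ncard_le_of_ncard_fiber_le R.rationalMap {P | τ.germMap f P = 0} T
    (fun y _ => hin y) hout
  rw [Finset.card_compl, ← Nat.card_eq_fintype_card] at hcount
  have hTcard : T.card ≤ Nat.card (RationalPoint R.strC) :=
    Nat.card_eq_fintype_card (α := RationalPoint R.strC) ▸ T.card_le_univ
  zify [hTcard] at hcount
  rw [Int.toNat_of_nonneg (nonneg_of_mem_sections hU f.2 hf0)] at hcount
  nlinarith [mul_nonneg (sub_nonneg.mpr hT) (sub_nonneg.mpr hb)]

theorem Trivialization.le_encard_support [Finite k] (hR : R.IsNormalized) {e : ℤ}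
    (hRe : R.HasInvariant e) (he : 0 ≤ e) {b : ℤ} {𝔟 : CurveDivisor R.C}
    (hb : b ≤ Nat.card k + 1) (τ : R.Trivialization b 𝔟) {f : R.sections b 𝔟} (hf : f ≠ 0) :
    ((Nat.card (RationalPoint R.strX) - degree R.strC 𝔟 * (Nat.card k + 1) -
      (Nat.card (RationalPoint R.strC) - degree R.strC 𝔟) * b).toNat : ℕ∞) ≤
      {P | τ.germMap f P ≠ 0}.encard := by
  have hzeros := τ.ncard_zeros_le hR hRe he hb hf
  have hcompl : {P | τ.germMap f P = 0}.ncard + {P | τ.germMap f P ≠ 0}.ncard =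
      Nat.card (RationalPoint R.strX) := Set.ncard_add_ncard_compl _
  rw [← Set.Finite.cast_ncard_eq (Set.toFinite _), Nat.cast_le]
  omega

end RuledSurface

theorem le_minDist_iff {ι k : Type*} [Field k] {E : Submodule k (ι → k)} {d : ℕ∞} :
    d ≤ minDist E ↔ ∀ c ∈ E, c ≠ 0 → d ≤ {i | c i ≠ 0}.encard := by
  simp only [minDist, le_iInf_iff]
  refine ⟨fun h c hc hc0 => h c hc 0 E.zero_mem hc0, fun h c hc c' hc' hne => ?_⟩
  simpa only [Pi.sub_apply, sub_ne_zero] using h _ (E.sub_mem hc hc') (sub_ne_zero.mpr hne)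

end RuledCode

end

theorem theorem4p9 {k : Type u} [Field k] [Finite k] (R : RuledCode.RuledSurface k)
    (hR : R.IsNormalized) (e : ℤ) (hRe : R.HasInvariant e) (he : 0 ≤ e)
    (q a n : ℕ) (hq : q = Nat.card k) (ha : a = Nat.card (RuledCode.RationalPoint R.strC))
    (hn : n = Nat.card (RuledCode.RationalPoint R.strX))
    (b₁ b₂ : ℤ) (𝔟 : RuledCode.CurveDivisor R.C) (h𝔟 : RuledCode.degree R.strC 𝔟 = b₂)
    (hb₂ : b₂ < a) (hpos : 0 < (n : ℤ) - b₂ * (q + 1) - (a - b₂) * b₁) :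
    Finite (RuledCode.RationalPoint R.strC) ∧ Finite (RuledCode.RationalPoint R.strX) ∧
    n = a * (q + 1) ∧
    (∀ x : R.X, ∃ t : R.X.functionField, R.IsLocalEquation b₁ 𝔟 x t) ∧
    FiniteDimensional k (R.sections b₁ 𝔟) ∧
    ∀ τ : R.Trivialization b₁ 𝔟,
      Module.finrank k τ.code = Module.finrank k (R.sections b₁ 𝔟) ∧
      (((n : ℤ) - b₂ * (q + 1) - (a - b₂) * b₁).toNat : ℕ∞) ≤ RuledCode.minDist τ.code := by
  subst hq ha hn h𝔟
  have hcard := R.card_rationalPoint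
  have hb₁ : b₁ ≤ Nat.card k + 1 := by
    push_cast [hcard] at hpos
    nlinarith
  have hweight (τ : R.Trivialization b₁ 𝔟) {f : R.sections b₁ 𝔟} (hf : f ≠ 0) :=
    τ.le_encard_support hR hRe he hb₁ hf
  have hinj (τ : R.Trivialization b₁ 𝔟) : Function.Injective τ.germMap := by
    refine (injective_iff_map_eq_zero _).mpr fun f hf => ?_
    by_contra hf0
    have h := hweight τ hf0
    simp only [hf, Pi.zero_apply, ne_eq, not_true_eq_false, Set.ofPred_false, Set.encard_empty,
      nonpos_iff_eq_zero, Nat.cast_eq_zero] at h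
    omega
  choose t ht using fun x => RuledCode.RuledSurface.exists_isLocalEquation
    (RuledCode.RuledSurface.SelfIntersection.hasUniformizers hRe) b₁ 𝔟 x
  refine ⟨inferInstance, inferInstance, hcard, fun x => ⟨t x, ht x⟩, ?_, fun τ => ⟨?_, ?_⟩⟩
  · exact .of_injective _ (hinj ⟨fun P => t P.1, fun P => ht P.1⟩)
  · exact LinearMap.finrank_range_of_inj (hinj τ)
  · refine RuledCode.le_minDist_iff.mpr ?_
    rintro _ ⟨f, rfl⟩ hf
    exact hweight τ fun h => hf (by rw [h, map_zero])
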